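/- Fix $\delta\in(-1,\infty)$ and put $\tau=\tau(\delta)=3+\delta$. The \emph{Pólya point tree} with parameter $\delta$ (the local limit of the preferential attachment model in which each new vertex attaches one edge, with shift $\delta$) is the following random rooted tree. Every vertex $u$ has an age $A_u\in[0,1]$, and every vertex other than the root $\phi$ has a label $\mathsf{y}$ (younger than its parent) or $\mathsf{o}$ (older than its parent). The age $A_\phi$ is uniform on $[0,1]$. Given a vertex $u$ with its age and label, its children are as follows. (1) If $u=\phi$ or $u$ has label $\mathsf{o}$, then $u$ has exactly one child of label $\mathsf{o}$; this child has age $U^{\frac{2+\delta}{1+\delta}}A_u$, where $U$ is uniform on $[0,1]$ and independent of everything else. If $u$ has label $\mathsf{y}$, then it has no child of label $\mathsf{o}$. (2) The ages of the children of $u$ with label $\mathsf{y}$ are the points of a Poisson point process on $[A_u,1]$ with intensity $$\rho_u(x)=\frac{\Gamma_u}{2+\delta}\,\frac{x^{-(1+\delta)/(2+\delta)}}{A_u^{1/(2+\delta)}},$$ where $\Gamma_u$ is independent of everything else and has the Gamma distribution with rate $1$ and with shape $1+\delta$ if $u$ is the root or has label $\mathsf{y}$, and shape $2+\delta$ if $u$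 has label $\mathsf{o}$. Let $d_\phi$ be the number of children of $\phi$, let $d_1,\dots,d_{d_\phi}$ be the numbers of children of the children of $\phi$, and let $\mu$ be the law on $\mathbb R$ of the friendship bias of the root, $$\Delta_\phi=\Big[\frac1{d_\phi}\sum_{j=1}^{d_\phi}(d_j+1)-d_\phi\Big]\mathbf 1_{\{d_\phi\neq0\}}.$$ For positive functions $f,g$, write $f(x)\gtrsim g(x)$ if $\liminf_{x\to\infty}f(x)/g(x)>0$ and $f(x)\lesssim g(x)$ if $\limsup_{x\to\infty}f(x)/g(x)<\infty$. Then, as $x\to\infty$ through the real numbers, $$\mu([x,\infty))\gtrsim\begin{cases}x^{-(3\tau-4)},&\delta\in(-1,0),\\ x^{-(2\tau-1)},&\delta\in[0,\infty),\end{cases}$$ and $$\mu([x,\infty))\lesssim\begin{cases}x^{-(3-\tau)},&\delta\in[-\tfrac12,0),\\ x^{-1},&\delta=0,\\ x^{-(\tau-3)},&\delta\in(0,\infty).\end{cases}$$ -/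

import Mathlib

open MeasureTheory ProbabilityTheory Set Filter

noncomputable section

namespace PolyaPointTree

/-- Ulam-Harris words. The root is the empty word, and `j :: u` is the child of `u` with
(zero-based) index `j`: the letter appended last is the head of the list. -/
abbrev Word : Type := List ℕ

/-- The two labels: `y` for a vertex younger than its parent, `o` for a vertex older than its
parent. -/
inductive Label : Type
  | y
  | o
  deriving DecidableEq

/-- The label carried by the vertex with a given word; the root carries none. The first child of
the root and the first child of a vertex of label `o` have label `o`, all other vertices have
label `y`. -/
def label : Word → Option Label
  | [] => none
  | j :: u => if label u ≠ some Label.y ∧ j = 0 then some Label.o else some Label.y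

/-- The number of children of label `o`: one if the vertex is the root or has label `o`,
and zero otherwise. -/
def numOld (u : Word) : ℕ := if label u = some Label.y then 0 else 1

/-- The shape parameter of the Gamma variable attached to a vertex. -/
def gammaShape (δ : ℝ) (u : Word) : ℝ :=
  if label u = some Label.o then 2 + δ else 1 + δ

/-- The independent randomness attached to one vertex: a uniform variable `U`, a Gamma variable
`Γ`, and the interarrival times of a unit-rate Poisson process on `[0, ∞)`. -/
abbrev Noise : Type := ℝ × ℝ × (ℕ → ℝ)

instance : IsProbabilityMeasure (expMeasure 1) := isProbabilityMeasure_expMeasure one_pos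

/-- The law of the randomness attached to the vertex `u`: the three components are
independent, and the interarrival times are independent standard exponentials. -/
def noiseLaw (δ : ℝ) (u : Word) : Measure Noise :=
  (volume.restrict (Icc (0 : ℝ) 1)).prod
    ((gammaMeasure (gammaShape δ u) 1).prod (Measure.infinitePi fun _ : ℕ => expMeasure 1))

theorem isProbabilityMeasure_noiseLaw {δ : ℝ} (hδ : -1 < δ) (u : Word) :
    IsProbabilityMeasure (noiseLaw δ u) := by
  have h1 : IsProbabilityMeasure (volume.restrict (Icc (0 : ℝ) 1)) := ⟨by simp⟩
  have h2 : IsProbabilityMeasure (gammaMeasure (gammaShape δ u) 1) := by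
    apply isProbabilityMeasure_gammaMeasure _ one_pos
    unfold gammaShape
    split_ifs <;> linarith
  unfold noiseLaw
  infer_instance

/-- The sample space: independent randomness for all words. -/
abbrev Sample : Type := Word → Noise

/-- The probability measure on the sample space, under which the randomness attached to different
words is independent. -/
def sampleLaw (δ : ℝ) (hδ : -1 < δ) : Measure Sample :=
  haveI : ∀ u, IsProbabilityMeasure (noiseLaw δ u) := isProbabilityMeasure_noiseLaw hδ
  Measure.infinitePi (noiseLaw δ)

/-- The uniform variable attached to the vertex `u`. -/
def unif (ω : Sample) (u : Word) : ℝ := (ω u).1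

/-- The Gamma variable attached to the vertex `u`. -/
def gam (ω : Sample) (u : Word) : ℝ := (ω u).2.1

/-- The `n`-th arrival time (counted from zero) of the unit-rate Poisson process attached to the
vertex `u`. -/
def arrival (ω : Sample) (u : Word) (n : ℕ) : ℝ := ∑ i ∈ Finset.range (n + 1), (ω u).2.2 i

/-- The intensity at the age `x` of the Poisson point process of the younger children of a vertex
with age `a` and Gamma variable `g`. -/
def intensity (δ a g x : ℝ) : ℝ :=
  g / (2 + δ) * (x ^ (-((1 + δ) / (2 + δ))) / a ^ (1 / (2 + δ)))

/-- The mass that the intensity puts on `[a, x]`. -/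
def cumIntensity (δ a g x : ℝ) : ℝ := ∫ t in a..x, intensity δ a g t

/-- The point at which the cumulative intensity reaches the level `s`. The images under this map
of the arrival times of a unit-rate Poisson process are, in increasing order, the points of a
Poisson point process on `[a, ∞)` with the given intensity; those arrival times that are at most
`cumIntensity δ a g 1` give the points in `[a, 1]`. -/
def youngAge (δ a g s : ℝ) : ℝ := sInf {x : ℝ | a ≤ x ∧ s ≤ cumIntensity δ a g x}

/-- The age of the vertex `u`. The root has a uniform age, an older child of `u` has the age
`U ^ ((2 + δ) / (1 + δ))` times the age of `u`, and the ages of the younger children of `u` are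
the ordered points of the Poisson point process of `u`. -/
def age (δ : ℝ) (ω : Sample) : Word → ℝ
  | [] => unif ω []
  | j :: u =>
    if j < numOld u then unif ω (j :: u) ^ ((2 + δ) / (1 + δ)) * age δ ω u
    else youngAge δ (age δ ω u) (gam ω u) (arrival ω u (j - numOld u))

/-- The number of children of label `y`: the number of points of the Poisson point process of `u`
in `[age of u, 1]`. -/
def numYoung (δ : ℝ) (ω : Sample) (u : Word) : ℕ :=
  Set.ncard {n : ℕ | arrival ω u n ≤ cumIntensity δ (age δ ω u) (gam ω u) 1}

/-- The number of children of `u`. The Pólya point tree consists of the words all of whose letters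
are smaller than the number of children of the vertex to which they are appended. -/
def numChildren (δ : ℝ) (ω : Sample) (u : Word) : ℕ := numOld u + numYoung δ ω u

/-- The friendship bias of the root of the rooted tree whose vertex `u` has `c u` children: the
average degree of the neighbours of the root minus the degree of the root, and zero if the root
has no neighbours. -/
def rootBias (c : Word → ℕ) : ℝ :=
  if c [] = 0 then 0
  else (∑ j ∈ Finset.range (c []), ((c [j] : ℝ) + 1)) / (c [] : ℝ) - (c [] : ℝ)

/-- The law `μ` of the friendship bias of the root of the Pólya point tree with parameter `δ`. -/
def biasLaw (δ : ℝ) (hδ : -1 < δ) : Measure ℝ :=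
  (sampleLaw δ hδ).map fun ω => rootBias (numChildren δ ω)

end PolyaPointTree

end

/-
The tail of the bias is governed by the older child of the root. That child has age
`U ^ ((2 + δ) / (1 + δ)) * A`, where `A` is the age of the root, and a vertex of age `a` has about
`a ^ (-(1 / (2 + δ)))` younger children, so the older child has more than `x` of them with
probability of order `x ^ (-(1 + δ))`. The younger children of the root cannot produce a heavier
tail: they have age at least `A`, so conditionally on `A` the `p`-th moment of their degrees is at
most of order `A ^ (-(p / (2 + δ)))`, which is integrable for `p < 2 + δ`, and Markov's inequality
applies with `p = max 1 (1 + δ)`. Conversely, with positive probability the root has no younger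
child, and then its bias is the number of children of its older child.
-/

open scoped ENNReal

noncomputable section

namespace PolyaPointTree

section Asymptotics

variable {f : ℝ → ℝ≥0∞} {a b : ℝ} {c : ℝ≥0∞}

theorem eventually_div_ofReal_rpow_le (hab : a ≤ b) :
    ∀ᶠ x in atTop, f x / ENNReal.ofReal (x ^ b) ≤ f x / ENNReal.ofReal (x ^ a) := by
  filter_upwards [eventually_ge_atTop 1] with x hx
  gcongr

theorem liminf_div_ofReal_rpow_pos (hc : 0 < c)
    (h : ∀ᶠ x in atTop, c * ENNReal.ofReal (x ^ a) ≤ f x) :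
    0 < liminf (fun x => f x / ENNReal.ofReal (x ^ a)) atTop := by
  refine hc.trans_le (le_liminf_of_le (by isBoundedDefault) ?_)
  filter_upwards [h, eventually_gt_atTop 0] with x hx hx0
  rwa [ENNReal.le_div_iff_mul_le (by simp [Real.rpow_pos_of_pos hx0]) (by simp)]

theorem limsup_div_ofReal_rpow_lt_top (hc : c < ⊤)
    (h : ∀ᶠ x in atTop, f x ≤ c * ENNReal.ofReal (x ^ a)) :
    limsup (fun x => f x / ENNReal.ofReal (x ^ a)) atTop < ⊤ :=
  (limsup_le_of_le (by isBoundedDefault)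
    (h.mono fun _ hx => ENNReal.div_le_of_le_mul hx)).trans_lt hc

end Asymptotics

section Elementary

theorem ofReal_natCast_add_one (k : ℕ) : ENNReal.ofReal ((k : ℝ) + 1) = k + 1 := by
  rw [ENNReal.ofReal_add k.cast_nonneg zero_le_one, ENNReal.ofReal_natCast, ENNReal.ofReal_one]

theorem sum_mul_rpow_le {ι : Type*} (s : Finset ι) {w : ι → ℝ≥0∞} (f : ι → ℝ≥0∞) {p : ℝ}
    (hw : ∑ i ∈ s, w i ≤ 1) (hp : 1 ≤ p) :
    (∑ i ∈ s, w i * f i) ^ p ≤ ∑ i ∈ s, w i * f i ^ p := by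
  have hp0 : 0 < p := by linarith
  have hweight : (∑ i ∈ s, w i) ^ (1 - p⁻¹) ≤ 1 :=
    ENNReal.rpow_le_one hw (sub_nonneg.2 (inv_le_one_of_one_le₀ hp))
  calc (∑ i ∈ s, w i * f i) ^ p
      ≤ ((∑ i ∈ s, w i) ^ (1 - p⁻¹) * (∑ i ∈ s, w i * f i ^ p) ^ p⁻¹) ^ p := by
        gcongr
        exact ENNReal.inner_le_weight_mul_Lp_of_nonneg s hp w f
    _ ≤ ((∑ i ∈ s, w i * f i ^ p) ^ p⁻¹) ^ p := by
        gcongr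
        exact mul_le_of_le_one_left' hweight
    _ = ∑ i ∈ s, w i * f i ^ p := ENNReal.rpow_inv_rpow hp0.ne' _

theorem lintegral_rpow_restrict_Icc_ne_top {s : ℝ} (hs : -1 < s) :
    ∫⁻ x, ENNReal.ofReal (x ^ s) ∂volume.restrict (Icc (0 : ℝ) 1) ≠ ⊤ := by
  have hint : IntegrableOn (fun x : ℝ => x ^ s) (Icc 0 1) :=
    (intervalIntegrable_iff_integrableOn_Icc_of_le zero_le_one).1
      (intervalIntegral.intervalIntegrable_rpow' hs)
  exact hint.lintegral_lt_top.ne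

theorem restrict_Icc_Iic (r : ℝ) :
    volume.restrict (Icc (0 : ℝ) 1) (Iic r) = ENNReal.ofReal (min r 1) := by
  have hset : Iic r ∩ Icc 0 1 = Icc 0 (min r 1) := by grind
  rw [Measure.restrict_apply measurableSet_Iic, hset, Real.volume_Icc, sub_zero]

theorem ae_restrict_Icc_mem_Ioc : ∀ᵐ x ∂volume.restrict (Icc (0 : ℝ) 1), x ∈ Ioc 0 1 := by
  rw [← restrict_Ioc_eq_restrict_Icc]
  exact ae_restrict_mem measurableSet_Ioc

theorem lintegral_rpow_le_rpow_lintegral {Ω : Type*} [MeasurableSpace Ω] {μ : Measure Ω}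
    [IsProbabilityMeasure μ] {f : Ω → ℝ≥0∞} (hf : AEMeasurable f μ) {s : ℝ} (hs0 : 0 < s)
    (hs1 : s ≤ 1) : ∫⁻ x, f x ^ s ∂μ ≤ (∫⁻ x, f x ∂μ) ^ s := by
  have h := eLpNorm'_le_eLpNorm'_of_exponent_le hs0 hs1 μ hf.aestronglyMeasurable
  simp only [eLpNorm', enorm_eq_self, ENNReal.rpow_one, div_one, one_div] at h
  exact (ENNReal.rpow_inv_le_iff hs0).1 h

end Elementary

section Gamma

variable {a r q s : ℝ}

theorem gammaPDF_mul_rpow_mul_exp (ha : 0 < a) (hr : 0 < r) (hq : 0 < a + q) (hs : 0 < r + s)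
    {x : ℝ} (hx : x ≠ 0) :
    gammaPDF a r x * ENNReal.ofReal (x ^ q * Real.exp (-(s * x))) =
      ENNReal.ofReal (r ^ a * Real.Gamma (a + q) / (Real.Gamma a * (r + s) ^ (a + q))) *
        gammaPDF (a + q) (r + s) x := by
  have := Real.Gamma_pos_of_pos ha
  have := Real.Gamma_pos_of_pos hq
  rcases hx.lt_or_gt with hneg | hpos
  · rw [gammaPDF_of_neg hneg, gammaPDF_of_neg hneg, zero_mul, mul_zero]
  · rw [gammaPDF_of_nonneg hpos.le, gammaPDF_of_nonneg hpos.le,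
      ← ENNReal.ofReal_mul (by positivity), ← ENNReal.ofReal_mul (by positivity)]
    congr 1
    have hexp : Real.exp (-((r + s) * x)) = Real.exp (-(r * x)) * Real.exp (-(s * x)) := by
      rw [← Real.exp_add]; ring_nf
    have hrpow : x ^ (a + q - 1) = x ^ (a - 1) * x ^ q := by
      rw [← Real.rpow_add hpos]; ring_nf
    rw [hexp, hrpow]
    field_simp

theorem measurable_gammaPDF (a r : ℝ) : Measurable (gammaPDF a r) :=
  (measurable_gammaPDFReal a r).ennreal_ofReal

theorem lintegral_rpow_mul_exp_gammaMeasure (ha : 0 < a) (hr : 0 < r) (hq : 0 < a + q)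
    (hs : 0 < r + s) :
    ∫⁻ x, ENNReal.ofReal (x ^ q * Real.exp (-(s * x))) ∂gammaMeasure a r =
      ENNReal.ofReal (r ^ a * Real.Gamma (a + q) / (Real.Gamma a * (r + s) ^ (a + q))) := by
  rw [gammaMeasure, lintegral_withDensity_eq_lintegral_mul _ (measurable_gammaPDF a r)
    (by fun_prop)]
  simp only [Pi.mul_apply]
  rw [lintegral_congr_ae ((Measure.ae_ne volume 0).mono fun x hx =>
      gammaPDF_mul_rpow_mul_exp ha hr hq hs hx),
    lintegral_const_mul _ (measurable_gammaPDF _ _), lintegral_gammaPDF_eq_one hq hs, mul_one]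

theorem lintegral_rpow_gammaMeasure_ne_top (ha : 0 < a) (hr : 0 < r) (hq : 0 ≤ q) :
    ∫⁻ x, ENNReal.ofReal (x ^ q) ∂gammaMeasure a r ≠ ⊤ := by
  have h := lintegral_rpow_mul_exp_gammaMeasure (s := 0) ha hr (by linarith : 0 < a + q)
    (by linarith)
  simp only [zero_mul, neg_zero, Real.exp_zero, mul_one] at h
  rw [h]
  exact ENNReal.ofReal_ne_top

theorem gammaMeasure_ae_pos (a r : ℝ) : ∀ᵐ x ∂gammaMeasure a r, 0 < x := by
  rw [gammaMeasure, ae_withDensity_iff (measurable_gammaPDF a r)]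
  filter_upwards [Measure.ae_ne volume 0] with x hx hpdf
  by_contra hneg
  exact hpdf (gammaPDF_of_neg ((not_lt.1 hneg).lt_of_ne hx))

theorem lintegral_one_add_rpow_gammaMeasure_ne_top (ha : 0 < a) (hr : 0 < r) (hq : 0 ≤ q) :
    ∫⁻ x, ENNReal.ofReal ((1 + x) ^ q) ∂gammaMeasure a r ≠ ⊤ := by
  have := isProbabilityMeasure_gammaMeasure ha hr
  have hle : ∀ᵐ x ∂gammaMeasure a r, ENNReal.ofReal ((1 + x) ^ q) ≤
      ENNReal.ofReal (2 ^ q) * (1 + ENNReal.ofReal (x ^ q)) := by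
    filter_upwards [gammaMeasure_ae_pos a r] with x hx
    rw [← ENNReal.ofReal_one, ← ENNReal.ofReal_add zero_le_one (by positivity),
      ← ENNReal.ofReal_mul (by positivity)]
    refine ENNReal.ofReal_le_ofReal ?_
    have hmax : max 1 x ^ q ≤ 1 + x ^ q := by
      rcases max_choice 1 x with h | h <;> rw [h]
      · simpa using Real.rpow_nonneg hx.le q
      · simp
    calc (1 + x) ^ q ≤ (2 * max 1 x) ^ q := by
          gcongr
          linarith [le_max_left 1 x, le_max_right 1 x]
      _ = 2 ^ q * max 1 x ^ q := Real.mul_rpow zero_le_two (by positivity)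
      _ ≤ 2 ^ q * (1 + x ^ q) := by gcongr
  refine ne_top_of_le_ne_top ?_ (lintegral_mono_ae hle)
  rw [lintegral_const_mul _ (by fun_prop), lintegral_add_left measurable_const, lintegral_one,
    measure_univ]
  have := lintegral_rpow_gammaMeasure_ne_top ha hr hq
  finiteness

theorem gammaMeasure_apply_ne_zero (ha : 0 < a) (hr : 0 < r) {S : Set ℝ} (hS : MeasurableSet S)
    (hpos : S ⊆ Ioi 0) (hvol : volume S ≠ 0) : gammaMeasure a r S ≠ 0 := by
  intro h0
  rw [gammaMeasure, withDensity_apply _ hS,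
    setLIntegral_eq_zero_iff hS (measurable_gammaPDF a r)] at h0
  refine hvol (measure_mono_null (fun x hx => ?_) (ae_iff.1 h0))
  simp only [mem_ofPred_eq, Classical.not_imp]
  have hx0 : 0 < x := hpos hx
  have := Real.Gamma_pos_of_pos ha
  refine ⟨hx, ?_⟩
  rw [gammaPDF_of_nonneg hx0.le]
  exact (ENNReal.ofReal_pos.2 (by positivity)).ne'

end Gamma

section Arrivals

/-- The `n`-th arrival time, counted from zero, of the process with interarrival times `t`. -/
def arrivalTime (t : ℕ → ℝ) (n : ℕ) : ℝ := ∑ i ∈ Finset.range (n + 1), t i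

/-- The number of arrivals up to time `l`, with the junk value zero if there are infinitely
many. -/
def arrivalCount (t : ℕ → ℝ) (l : ℝ) : ℕ := Set.ncard {n : ℕ | arrivalTime t n ≤ l}

/-- The interarrival times of a locally finite point process on `[0, ∞)`. -/
structure IsInterarrival (t : ℕ → ℝ) : Prop where
  nonneg : ∀ i, 0 ≤ t i
  unbounded : ∀ l, ∃ n, l < arrivalTime t n

/-- The law of the interarrival times of a unit-rate Poisson process. -/
def interarrivalLaw : Measure (ℕ → ℝ) := Measure.infinitePi fun _ : ℕ => expMeasure 1

variable {t : ℕ → ℝ} {l : ℝ} {m : ℕ}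

theorem arrivalTime_mono (ht : ∀ i, 0 ≤ t i) : Monotone (arrivalTime t) := fun _ _ h =>
  Finset.sum_le_sum_of_subset_of_nonneg (Finset.range_mono (by gcongr)) fun i _ _ => ht i

theorem IsInterarrival.lt_arrivalCount_iff (ht : IsInterarrival t) :
    m < arrivalCount t l ↔ arrivalTime t m ≤ l := by
  classical
  have hset : {n | arrivalTime t n ≤ l} = Iio (Nat.find (ht.unbounded l)) := by
    ext n
    simp only [mem_ofPred_eq, mem_Iio, Nat.lt_find_iff, not_lt]
    exact ⟨fun h k hk => (arrivalTime_mono ht.nonneg hk).trans h, fun h => h n le_rfl⟩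
  rw [arrivalCount, hset, ncard_eq_toFinset_card', toFinset_Iio, Nat.card_Iio, ← mem_Iio, ← hset,
    mem_ofPred_eq]

theorem IsInterarrival.arrivalCount_mono (ht : IsInterarrival t) : Monotone (arrivalCount t) :=
  fun _ _ h => le_of_forall_lt fun _ hm =>
    ht.lt_arrivalCount_iff.2 ((ht.lt_arrivalCount_iff.1 hm).trans h)

@[fun_prop]
theorem measurable_arrivalTime (n : ℕ) : Measurable fun t : ℕ → ℝ => arrivalTime t n := by
  unfold arrivalTime
  fun_prop

@[fun_prop]
theorem measurable_arrivalCount {α : Type*} [MeasurableSpace α] {t : α → ℕ → ℝ} {l : α → ℝ}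
    (ht : Measurable t) (hl : Measurable l) : Measurable fun x => arrivalCount (t x) (l x) :=
  measurable_ncard.comp <| measurable_set_iff.2 fun n => measurableSet_setOfPred.1 <|
    measurableSet_le ((measurable_arrivalTime n).comp ht) hl

instance : IsProbabilityMeasure interarrivalLaw := by
  unfold interarrivalLaw
  infer_instance

theorem measurePreserving_eval_interarrivalLaw (i : ℕ) :
    MeasurePreserving (fun t : ℕ → ℝ => t i) interarrivalLaw (expMeasure 1) :=
  measurePreserving_eval_infinitePi (fun _ : ℕ => expMeasure 1) i

theorem ae_interarrivalLaw_nonneg : ∀ᵐ t ∂interarrivalLaw, ∀ i, 0 ≤ t i :=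
  ae_all_iff.2 fun i => (measurePreserving_eval_interarrivalLaw i).quasiMeasurePreserving.ae
    ((gammaMeasure_ae_pos 1 1).mono fun _ => le_of_lt)

theorem lintegral_exp_neg_expMeasure :
    ∫⁻ x, ENNReal.ofReal (Real.exp (-x)) ∂expMeasure 1 = 2⁻¹ := by
  have h := lintegral_rpow_mul_exp_gammaMeasure (a := 1) (r := 1) (q := 0) (s := 1)
    (by norm_num) (by norm_num) (by norm_num) (by norm_num)
  norm_num at h
  rwa [one_div, ENNReal.ofReal_inv_of_pos two_pos, ENNReal.ofReal_ofNat] at h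

theorem lintegral_id_expMeasure : ∫⁻ x, ENNReal.ofReal x ∂expMeasure 1 = 1 := by
  have h := lintegral_rpow_mul_exp_gammaMeasure (a := 1) (r := 1) (q := 1) (s := 0)
    (by norm_num) (by norm_num) (by norm_num) (by norm_num)
  norm_num at h
  exact h

theorem lintegral_exp_neg_arrivalTime (n : ℕ) :
    ∫⁻ t, ENNReal.ofReal (Real.exp (-arrivalTime t n)) ∂interarrivalLaw = 2⁻¹ ^ (n + 1) := by
  have hprod (t : ℕ → ℝ) : ENNReal.ofReal (Real.exp (-arrivalTime t n))
      = ∏ i ∈ Finset.range (n + 1), ENNReal.ofReal (Real.exp (-t i)) := by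
    rw [arrivalTime, ← Finset.sum_neg_distrib, Real.exp_sum,
      ENNReal.ofReal_prod_of_nonneg fun i _ => (Real.exp_pos _).le]
  have hindep := iIndepFun_infinitePi (P := fun _ : ℕ => expMeasure 1)
    (X := fun _ x => ENNReal.ofReal (Real.exp (-x))) fun _ => by fun_prop
  have hfactor (i : ℕ) : ∫⁻ t, ENNReal.ofReal (Real.exp (-t i)) ∂interarrivalLaw = 2⁻¹ :=
    ((measurePreserving_eval_interarrivalLaw i).lintegral_comp
      (f := fun x => ENNReal.ofReal (Real.exp (-x))) (by fun_prop)).trans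
      lintegral_exp_neg_expMeasure
  simp_rw [hprod]
  refine (lintegral_prod_eq_prod_lintegral_of_indepFun _ _ hindep fun _ => by fun_prop).trans ?_
  exact (Finset.prod_congr rfl fun i _ => hfactor i).trans (by simp)

theorem lintegral_arrivalTime (n : ℕ) :
    ∫⁻ t, ENNReal.ofReal (arrivalTime t n) ∂interarrivalLaw = n + 1 := by
  have hsum : ∀ᵐ t ∂interarrivalLaw, ENNReal.ofReal (arrivalTime t n) =
      ∑ i ∈ Finset.range (n + 1), ENNReal.ofReal (t i) := by
    filter_upwards [ae_interarrivalLaw_nonneg] with t ht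
    exact ENNReal.ofReal_sum_of_nonneg fun i _ => ht i
  have hterm (i : ℕ) : ∫⁻ t, ENNReal.ofReal (t i) ∂interarrivalLaw = 1 :=
    ((measurePreserving_eval_interarrivalLaw i).lintegral_comp ENNReal.measurable_ofReal).trans
      lintegral_id_expMeasure
  rw [lintegral_congr_ae hsum, lintegral_finsetSum _ fun i _ => by fun_prop]
  simp [hterm]

theorem interarrivalLaw_arrivalTime_le (n : ℕ) (l : ℝ) :
    interarrivalLaw {t | arrivalTime t n ≤ l} ≤ ENNReal.ofReal (Real.exp l) * 2⁻¹ ^ (n + 1) := by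
  have hsub : {t | arrivalTime t n ≤ l} ⊆
      {t | ENNReal.ofReal (Real.exp (-l)) ≤ ENNReal.ofReal (Real.exp (-arrivalTime t n))} :=
    fun t ht => ENNReal.ofReal_le_ofReal (Real.exp_le_exp.2 (neg_le_neg ht))
  refine (measure_mono hsub).trans ((meas_ge_le_lintegral_div (by fun_prop)
    (by simp [Real.exp_pos]) (by simp)).trans_eq ?_)
  rw [lintegral_exp_neg_arrivalTime, Real.exp_neg, ENNReal.ofReal_inv_of_pos (Real.exp_pos l),
    div_eq_mul_inv, inv_inv, mul_comm]

theorem ae_isInterarrival : ∀ᵐ t ∂interarrivalLaw, IsInterarrival t := by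
  have hunbounded : ∀ᵐ t ∂interarrivalLaw, ∀ k : ℕ, ∃ n, (k : ℝ) < arrivalTime t n := by
    refine ae_all_iff.2 fun k => ?_
    have hlim : Tendsto (fun n => ENNReal.ofReal (Real.exp k) * 2⁻¹ ^ (n + 1)) atTop (nhds 0) := by
      have h := (ENNReal.tendsto_pow_atTop_nhds_zero_of_lt_one ENNReal.one_half_lt_one).comp
        (tendsto_add_atTop_nat 1)
      simpa using ENNReal.Tendsto.const_mul h (.inr ENNReal.ofReal_ne_top)
    refine ae_iff.2 (le_antisymm (ge_of_tendsto' hlim fun n => ?_) bot_le)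
    refine (measure_mono fun t ht => ?_).trans (interarrivalLaw_arrivalTime_le n k)
    simp only [mem_ofPred_eq, not_exists, not_lt] at ht
    exact ht n
  filter_upwards [ae_interarrivalLaw_nonneg, hunbounded] with t ht hu
  refine ⟨ht, fun l => ?_⟩
  obtain ⟨k, hk⟩ := exists_nat_ge l
  exact (hu k).imp fun n hn => hk.trans_lt hn

theorem half_le_interarrivalLaw_arrivalTime_le (n : ℕ) :
    2⁻¹ ≤ interarrivalLaw {t | arrivalTime t n ≤ 2 * (n + 1)} := by
  have hlate : interarrivalLaw {t | 2 * (n + 1) < arrivalTime t n} ≤ 2⁻¹ := by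
    have hsub : {t : ℕ → ℝ | 2 * (n + 1) < arrivalTime t n} ⊆
        {t | ENNReal.ofReal (2 * (n + 1)) ≤ ENNReal.ofReal (arrivalTime t n)} :=
      fun t ht => ENNReal.ofReal_le_ofReal (le_of_lt ht)
    refine (measure_mono hsub).trans ((meas_ge_le_lintegral_div (by fun_prop)
      (ENNReal.ofReal_pos.2 (by positivity)).ne' ENNReal.ofReal_ne_top).trans_eq ?_)
    rw [lintegral_arrivalTime, ENNReal.ofReal_mul zero_le_two, ofReal_natCast_add_one,
      ENNReal.ofReal_ofNat, div_eq_mul_inv, ENNReal.mul_inv (by simp) (by simp), mul_left_comm,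
      ENNReal.mul_inv_cancel (by simp) (by finiteness), mul_one]
  have hcompl : {t | arrivalTime t n ≤ 2 * (n + 1)} = {t | 2 * (n + 1) < arrivalTime t n}ᶜ := by
    ext t
    simp
  rw [hcompl, prob_compl_eq_one_sub (measurableSet_lt measurable_const (by fun_prop)),
    ← ENNReal.one_sub_inv_two]
  gcongr

theorem IsInterarrival.pow_arrivalCount_le (ht : IsInterarrival t) (l : ℝ) (z : ℝ≥0∞) :
    z ^ arrivalCount t l ≤
      1 + ∑' m, z ^ (m + 1) *
        (ENNReal.ofReal (Real.exp l) * ENNReal.ofReal (Real.exp (-arrivalTime t m))) := by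
  rcases hN : arrivalCount t l with _ | m
  · simp
  · have hm : arrivalTime t m ≤ l := ht.lt_arrivalCount_iff.1 (by lia)
    have hone : 1 ≤ ENNReal.ofReal (Real.exp l) * ENNReal.ofReal (Real.exp (-arrivalTime t m)) := by
      rw [← ENNReal.ofReal_mul (Real.exp_pos l).le, ← Real.exp_add]
      exact ENNReal.one_le_ofReal.2 (Real.one_le_exp (by linarith))
    exact (le_mul_of_one_le_right' hone).trans <|
      (ENNReal.le_tsum (f := fun m => z ^ (m + 1) * (ENNReal.ofReal (Real.exp l) *
        ENNReal.ofReal (Real.exp (-arrivalTime t m)))) m).trans le_add_self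

theorem lintegral_pow_arrivalCount_le (hl : 0 ≤ l) :
    ∫⁻ t, (3 / 2 : ℝ≥0∞) ^ arrivalCount t l ∂interarrivalLaw ≤ 4 * ENNReal.ofReal (Real.exp l) := by
  have hratio : (3 / 2 * 2⁻¹ : ℝ≥0∞) = 3 / 4 := by
    rw [div_eq_mul_inv, mul_assoc, ← ENNReal.mul_inv (by simp) (by simp), div_eq_mul_inv]
    norm_num
  have hgeom : ∑' m : ℕ, (3 / 4 : ℝ≥0∞) ^ (m + 1) = 3 := by
    have hsub : (1 - 3 / 4 : ℝ≥0∞) = 4⁻¹ := by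
      refine ENNReal.sub_eq_of_eq_add (by finiteness) ?_
      rw [← one_div, ENNReal.div_add_div_same, show (1 + 3 : ℝ≥0∞) = 4 by norm_num,
        ENNReal.div_self (by simp) (by simp)]
    rw [ENNReal.tsum_geometric_add_one, hsub, inv_inv, ENNReal.div_mul_cancel (by simp) (by simp)]
  have hterm (m : ℕ) : ∫⁻ t, (3 / 2) ^ (m + 1) * (ENNReal.ofReal (Real.exp l) *
      ENNReal.ofReal (Real.exp (-arrivalTime t m))) ∂interarrivalLaw =
      ENNReal.ofReal (Real.exp l) * (3 / 4) ^ (m + 1) := by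
    rw [lintegral_const_mul _ (by fun_prop), lintegral_const_mul _ (by fun_prop),
      lintegral_exp_neg_arrivalTime, mul_left_comm, ← mul_pow, hratio]
  have hone : 1 ≤ ENNReal.ofReal (Real.exp l) := ENNReal.one_le_ofReal.2 (Real.one_le_exp hl)
  calc ∫⁻ t, (3 / 2 : ℝ≥0∞) ^ arrivalCount t l ∂interarrivalLaw
      ≤ ∫⁻ t, 1 + ∑' m, (3 / 2) ^ (m + 1) * (ENNReal.ofReal (Real.exp l) *
          ENNReal.ofReal (Real.exp (-arrivalTime t m))) ∂interarrivalLaw := by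
        exact lintegral_mono_ae (ae_isInterarrival.mono fun t ht => ht.pow_arrivalCount_le l _)
    _ = 1 + ENNReal.ofReal (Real.exp l) * 3 := by
        rw [lintegral_add_left measurable_const, lintegral_tsum fun m => by fun_prop,
          lintegral_one, measure_univ]
        simp_rw [hterm]
        rw [ENNReal.tsum_mul_left, hgeom]
    _ ≤ ENNReal.ofReal (Real.exp l) + ENNReal.ofReal (Real.exp l) * 3 := by gcongr
    _ = 4 * ENNReal.ofReal (Real.exp l) := by ring

theorem natCast_add_one_rpow_le {p : ℝ} (hp : 0 ≤ p) (hl : 0 ≤ l) (k : ℕ) :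
    ((k : ℝ≥0∞) + 1) ^ p ≤ ENNReal.ofReal ((p / Real.log (3 / 2)) ^ p) *
      ENNReal.ofReal (1 + l) ^ p * ((3 / 2 : ℝ≥0∞) ^ (k + 1)) ^ (1 + l)⁻¹ := by
  have hlog : 0 < Real.log (3 / 2) := Real.log_pos (by norm_num)
  have hl1 : 0 < 1 + l := by linarith
  have hdom := rpow_abs_le_mul_exp_abs (((k : ℝ) + 1) / (1 + l)) hp hlog.ne'
  rw [abs_of_pos hlog, abs_of_pos (by positivity), Real.div_rpow (by positivity) hl1.le,
    div_le_iff₀ (by positivity)] at hdom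
  have hexp : Real.exp (Real.log (3 / 2) * ((k + 1) / (1 + l))) =
      ((3 / 2 : ℝ) ^ (k + 1)) ^ (1 + l)⁻¹ := by
    rw [← Real.rpow_natCast, ← Real.rpow_mul (by norm_num), Real.rpow_def_of_pos (by norm_num)]
    push_cast
    ring_nf
  have hbase : (3 / 2 : ℝ≥0∞) = ENNReal.ofReal (3 / 2) := by
    rw [ENNReal.ofReal_div_of_pos two_pos, ENNReal.ofReal_ofNat, ENNReal.ofReal_ofNat]
  rw [← ofReal_natCast_add_one, hbase, ← ENNReal.ofReal_pow (by norm_num),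
    ENNReal.ofReal_rpow_of_pos (by positivity), ENNReal.ofReal_rpow_of_pos hl1,
    ENNReal.ofReal_rpow_of_pos (by positivity), ← ENNReal.ofReal_mul (by positivity),
    ← ENNReal.ofReal_mul (by positivity), ← hexp]
  exact ENNReal.ofReal_le_ofReal (hdom.trans_eq (by ring))

-- Jensen's inequality with the exponent `(1 + l)⁻¹` reduces the exponential moment, which is of
-- order `exp l`, to a factor that is bounded in `l`.
theorem exists_lintegral_arrivalCount_rpow_le {p : ℝ} (hp : 0 ≤ p) :
    ∃ K ≠ ⊤, ∀ l, 0 ≤ l → ∫⁻ t, ((arrivalCount t l : ℝ≥0∞) + 1) ^ p ∂interarrivalLaw ≤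
      K * ENNReal.ofReal (1 + l) ^ p := by
  refine ⟨ENNReal.ofReal ((p / Real.log (3 / 2)) ^ p) * (6 * ENNReal.ofReal (Real.exp 1)),
    by finiteness, fun l hl => ?_⟩
  have hl1 : 1 ≤ 1 + l := by linarith
  have hinv : (1 + l)⁻¹ ≤ 1 := inv_le_one_of_one_le₀ hl1
  have hexpMoment : ∫⁻ t, (3 / 2 : ℝ≥0∞) ^ (arrivalCount t l + 1) ∂interarrivalLaw ≤
      6 * ENNReal.ofReal (Real.exp l) := by
    simp_rw [pow_succ']
    rw [lintegral_const_mul' _ _ (by finiteness)]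
    refine (mul_le_mul_right (lintegral_pow_arrivalCount_le hl) _).trans_eq ?_
    rw [← mul_assoc, show (4 : ℝ≥0∞) = 2 * 2 by norm_num, ← mul_assoc,
      ENNReal.div_mul_cancel (by simp) (by simp), show (3 * 2 : ℝ≥0∞) = 6 by norm_num]
  have hroot : (6 * ENNReal.ofReal (Real.exp l)) ^ (1 + l)⁻¹ ≤ 6 * ENNReal.ofReal (Real.exp 1) := by
    rw [ENNReal.mul_rpow_of_nonneg _ _ (by positivity)]
    gcongr
    · exact (ENNReal.rpow_le_rpow_of_exponent_le (by norm_num) hinv).trans_eq (ENNReal.rpow_one _)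
    · rw [ENNReal.ofReal_rpow_of_pos (Real.exp_pos l), ← Real.exp_mul]
      gcongr
      exact mul_inv_le_one_of_le₀ (by linarith) (by linarith)
  calc ∫⁻ t, ((arrivalCount t l : ℝ≥0∞) + 1) ^ p ∂interarrivalLaw
      ≤ ∫⁻ t, ENNReal.ofReal ((p / Real.log (3 / 2)) ^ p) * ENNReal.ofReal (1 + l) ^ p *
          ((3 / 2 : ℝ≥0∞) ^ (arrivalCount t l + 1)) ^ (1 + l)⁻¹ ∂interarrivalLaw :=
        lintegral_mono fun t => natCast_add_one_rpow_le hp hl _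
    _ ≤ ENNReal.ofReal ((p / Real.log (3 / 2)) ^ p) * ENNReal.ofReal (1 + l) ^ p *
          (6 * ENNReal.ofReal (Real.exp l)) ^ (1 + l)⁻¹ := by
        rw [lintegral_const_mul _ (by fun_prop)]
        gcongr
        refine (lintegral_rpow_le_rpow_lintegral (by fun_prop) (by positivity) hinv).trans ?_
        gcongr
    _ ≤ ENNReal.ofReal ((p / Real.log (3 / 2)) ^ p) * ENNReal.ofReal (1 + l) ^ p *
          (6 * ENNReal.ofReal (Real.exp 1)) := by gcongr
    _ = _ := by ring

end Arrivals

section Noise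

/-- The properties that the randomness attached to a vertex has almost surely. -/
structure IsTypical (n : Noise) : Prop where
  unif_mem : n.1 ∈ Ioc 0 1
  gam_pos : 0 < n.2.1
  isInterarrival : IsInterarrival n.2.2

/-- The number of younger children of a vertex with age `a` and randomness `n`: the number of
arrivals up to the total mass of the intensity on `[a, 1]`. -/
def youngCount (δ : ℝ) (n : Noise) (a : ℝ) : ℕ :=
  arrivalCount n.2.2 (n.2.1 * (1 / a ^ (1 / (2 + δ)) - 1))

variable {δ : ℝ}

instance : IsProbabilityMeasure (volume.restrict (Icc (0 : ℝ) 1)) := ⟨by simp⟩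

theorem gammaShape_pos (hδ : -1 < δ) (u : Word) : 0 < gammaShape δ u := by
  unfold gammaShape
  split_ifs <;> linarith

theorem noiseLaw_prod (hδ : -1 < δ) (u : Word) (A B : Set ℝ) (C : Set (ℕ → ℝ)) :
    noiseLaw δ u (A ×ˢ B ×ˢ C) =
      volume.restrict (Icc (0 : ℝ) 1) A *
        (gammaMeasure (gammaShape δ u) 1 B * interarrivalLaw C) := by
  have := isProbabilityMeasure_gammaMeasure (gammaShape_pos hδ u) one_pos
  rw [noiseLaw, Measure.prod_prod, Measure.prod_prod, interarrivalLaw]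

theorem measurePreserving_fst_noiseLaw (hδ : -1 < δ) (u : Word) :
    MeasurePreserving Prod.fst (noiseLaw δ u) (volume.restrict (Icc (0 : ℝ) 1)) :=
  have := isProbabilityMeasure_gammaMeasure (gammaShape_pos hδ u) one_pos
  measurePreserving_fst

theorem lintegral_noiseLaw (hδ : -1 < δ) (u : Word) {f : Noise → ℝ≥0∞} (hf : Measurable f) :
    ∫⁻ n, f n ∂noiseLaw δ u = ∫⁻ g, ∫⁻ t, ∫⁻ x, f (x, g, t) ∂volume.restrict (Icc (0 : ℝ) 1)
      ∂interarrivalLaw ∂gammaMeasure (gammaShape δ u) 1 := by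
  have := isProbabilityMeasure_gammaMeasure (gammaShape_pos hδ u) one_pos
  rw [noiseLaw, lintegral_prod_symm _ hf.aemeasurable,
    lintegral_prod _ hf.lintegral_prod_left'.aemeasurable, interarrivalLaw]

theorem ae_isTypical (hδ : -1 < δ) (u : Word) : ∀ᵐ n ∂noiseLaw δ u, IsTypical n := by
  have := isProbabilityMeasure_gammaMeasure (gammaShape_pos hδ u) one_pos
  have hunif := Measure.quasiMeasurePreserving_fst (μ := volume.restrict (Icc (0 : ℝ) 1))
    (ν := (gammaMeasure (gammaShape δ u) 1).prod interarrivalLaw) |>.ae ae_restrict_Icc_mem_Ioc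
  have hrest := Measure.quasiMeasurePreserving_snd (μ := volume.restrict (Icc (0 : ℝ) 1))
    (ν := (gammaMeasure (gammaShape δ u) 1).prod interarrivalLaw)
  have hgam := hrest.ae (Measure.quasiMeasurePreserving_fst.ae (gammaMeasure_ae_pos _ 1))
  have harr := hrest.ae (Measure.quasiMeasurePreserving_snd.ae ae_isInterarrival)
  change ∀ᵐ n ∂(volume.restrict (Icc (0 : ℝ) 1)).prod
    ((gammaMeasure (gammaShape δ u) 1).prod interarrivalLaw), IsTypical n
  filter_upwards [hunif, hgam, harr] with n h1 h2 h3 using ⟨h1, h2, h3⟩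

theorem measurePreserving_eval_sampleLaw (hδ : -1 < δ) (u : Word) :
    MeasurePreserving (fun ω : Sample => ω u) (sampleLaw δ hδ) (noiseLaw δ u) :=
  have := isProbabilityMeasure_noiseLaw hδ
  measurePreserving_eval_infinitePi (noiseLaw δ) u

theorem measurePreserving_eval_pair_sampleLaw (hδ : -1 < δ) {u v : Word} (h : u ≠ v) :
    MeasurePreserving (fun ω : Sample => (ω u, ω v)) (sampleLaw δ hδ)
      ((noiseLaw δ u).prod (noiseLaw δ v)) :=
  have := isProbabilityMeasure_noiseLaw hδ
  ⟨by fun_prop, Measure.infinitePi_map_eval_prod h⟩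

theorem ae_forall_isTypical (hδ : -1 < δ) : ∀ᵐ ω ∂sampleLaw δ hδ, ∀ u, IsTypical (ω u) :=
  ae_all_iff.2 fun u =>
    (measurePreserving_eval_sampleLaw hδ u).quasiMeasurePreserving.ae (ae_isTypical hδ u)

@[fun_prop]
theorem measurable_youngCount {α : Type*} [MeasurableSpace α] {n : α → Noise} {a : α → ℝ}
    (hn : Measurable n) (ha : Measurable a) : Measurable fun x => youngCount δ (n x) (a x) := by
  unfold youngCount
  fun_prop

variable {n : Noise} {a b : ℝ} {m : ℕ}

theorem IsTypical.youngCount_anti (hn : IsTypical n) (hδ : -1 < δ) (ha : 0 < a) (hab : a ≤ b) :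
    youngCount δ n b ≤ youngCount δ n a := by
  have hg := hn.gam_pos
  have hexp : 0 ≤ 1 / (2 + δ) := one_div_nonneg.2 (by linarith)
  refine hn.isInterarrival.arrivalCount_mono ?_
  gcongr

theorem IsTypical.lt_youngCount_iff (hn : IsTypical n) (hδ : -1 < δ) (ha : 0 < a) :
    m < youngCount δ n a ↔ a * (1 + arrivalTime n.2.2 m / n.2.1) ^ (2 + δ) ≤ 1 := by
  have hg := hn.gam_pos
  have hδ2 : 0 < 2 + δ := by linarith
  have hS : 0 ≤ arrivalTime n.2.2 m := Finset.sum_nonneg fun i _ => hn.isInterarrival.nonneg i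
  have hroot : 0 < a ^ (1 / (2 + δ)) := by positivity
  have hpow : a * (1 + arrivalTime n.2.2 m / n.2.1) ^ (2 + δ) =
      (a ^ (1 / (2 + δ)) * (1 + arrivalTime n.2.2 m / n.2.1)) ^ (2 + δ) := by
    rw [Real.mul_rpow hroot.le (by positivity), ← Real.rpow_mul ha.le,
      one_div_mul_cancel hδ2.ne', Real.rpow_one]
  rw [youngCount, hn.isInterarrival.lt_arrivalCount_iff, ← div_le_iff₀' hg, le_sub_iff_add_le',
    le_div_iff₀' hroot, hpow, ← Real.rpow_le_rpow_iff (by positivity) zero_le_one hδ2,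
    Real.one_rpow]

/-- The age of an older child of a vertex of age `a` when the child carries the randomness `n`. -/
def olderAge (δ : ℝ) (n : Noise) (a : ℝ) : ℝ := n.1 ^ ((2 + δ) / (1 + δ)) * a

theorem IsTypical.lt_youngCount_olderAge_iff (hn : IsTypical n) (hδ : -1 < δ) (ha : 0 < a) :
    m < youngCount δ n (olderAge δ n a) ↔
      n.1 ≤ a ^ (-((1 + δ) / (2 + δ))) * (1 + arrivalTime n.2.2 m / n.2.1) ^ (-(1 + δ)) := by
  have hx : 0 < n.1 := hn.unif_mem.1
  have hg := hn.gam_pos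
  have hδ1 : 0 < 1 + δ := by linarith
  have hδ2 : 0 < 2 + δ := by linarith
  have hS : 0 ≤ arrivalTime n.2.2 m := Finset.sum_nonneg fun i _ => hn.isInterarrival.nonneg i
  have hy : 0 < 1 + arrivalTime n.2.2 m / n.2.1 := by positivity
  have hbound : (a ^ (-((1 + δ) / (2 + δ))) *
      (1 + arrivalTime n.2.2 m / n.2.1) ^ (-(1 + δ))) ^ ((2 + δ) / (1 + δ)) =
      (a * (1 + arrivalTime n.2.2 m / n.2.1) ^ (2 + δ))⁻¹ := by
    rw [Real.mul_rpow (by positivity) (by positivity), ← Real.rpow_mul ha.le,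
      ← Real.rpow_mul hy.le, neg_mul, neg_mul, div_mul_div_cancel₀ hδ2.ne', div_self hδ1.ne',
      mul_div_cancel₀ _ hδ1.ne', Real.rpow_neg_one, Real.rpow_neg hy.le, mul_inv]
  rw [hn.lt_youngCount_iff hδ (by unfold olderAge; positivity), olderAge, mul_assoc,
    ← le_inv_mul_iff₀' (by positivity), mul_one, ← hbound,
    Real.rpow_le_rpow_iff hx.le (by positivity) (by positivity)]

end Noise

section Tree

variable {δ : ℝ}

theorem cumIntensity_eq (hδ : -1 < δ) {a : ℝ} (ha : 0 < a) (g x : ℝ) :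
    cumIntensity δ a g x = g * (x ^ (1 / (2 + δ)) / a ^ (1 / (2 + δ)) - 1) := by
  have hδ2 : 0 < 2 + δ := by linarith
  have hexp : -((1 + δ) / (2 + δ)) + 1 = 1 / (2 + δ) := by field_simp; ring
  have hexp_gt : -1 < -((1 + δ) / (2 + δ)) := by
    have : 0 < 1 / (2 + δ) := by positivity
    linarith
  have : 0 < a ^ (1 / (2 + δ)) := by positivity
  unfold cumIntensity intensity
  rw [intervalIntegral.integral_const_mul, intervalIntegral.integral_div,
    integral_rpow (Or.inl hexp_gt), hexp]
  field_simp

theorem youngAge_eq (hδ : -1 < δ) {a g s : ℝ} (ha : 0 < a) (hg : 0 < g) (hs : 0 ≤ s) :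
    youngAge δ a g s = a * (1 + s / g) ^ (2 + δ) := by
  have hδ2 : 0 < 2 + δ := by linarith
  have hroot : 0 < a ^ (1 / (2 + δ)) := by positivity
  have hmem : ∀ x, a ≤ x → (s ≤ cumIntensity δ a g x ↔ a * (1 + s / g) ^ (2 + δ) ≤ x) := by
    intro x hax
    have hpow : (a * (1 + s / g) ^ (2 + δ)) ^ (1 / (2 + δ)) =
        a ^ (1 / (2 + δ)) * (1 + s / g) := by
      rw [Real.mul_rpow ha.le (by positivity), ← Real.rpow_mul (by positivity),
        mul_one_div_cancel hδ2.ne', Real.rpow_one]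
    rw [cumIntensity_eq hδ ha, ← div_le_iff₀' hg, le_sub_iff_add_le', le_div_iff₀' hroot, ← hpow,
      Real.rpow_le_rpow_iff (by positivity) (ha.le.trans hax) (by positivity)]
  have hle : a ≤ a * (1 + s / g) ^ (2 + δ) :=
    le_mul_of_one_le_right ha.le (Real.one_le_rpow (le_add_of_nonneg_right (by positivity)) hδ2.le)
  exact IsLeast.csInf_eq ⟨⟨hle, (hmem _ hle).2 le_rfl⟩, fun x hx => (hmem x hx.1).1 hx.2⟩

theorem label_singleton_zero : label [0] = some Label.o := by simp [label]

theorem label_singleton_succ (j : ℕ) : label [j + 1] = some Label.y := by simp [label]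

theorem numOld_singleton_zero : numOld [0] = 1 := by simp [numOld, label_singleton_zero]

theorem numOld_singleton_succ (j : ℕ) : numOld [j + 1] = 0 := by
  simp [numOld, label_singleton_succ]

theorem age_singleton_zero (ω : Sample) : age δ ω [0] = olderAge δ (ω [0]) (ω []).1 := by
  simp [age, numOld, label, olderAge, unif]

variable {ω : Sample}

theorem arrival_nonneg (hω : ∀ u, IsTypical (ω u)) (u : Word) (i : ℕ) : 0 ≤ arrival ω u i :=
  Finset.sum_nonneg fun k _ => (hω u).isInterarrival.nonneg k

theorem age_pos (hω : ∀ u, IsTypical (ω u)) (hδ : -1 < δ) (u : Word) : 0 < age δ ω u := by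
  induction u with
  | nil => exact (hω []).unif_mem.1
  | cons j u ih =>
    have hx : 0 < unif ω (j :: u) := (hω _).unif_mem.1
    have hg : 0 < gam ω u := (hω u).gam_pos
    have hs := arrival_nonneg hω u (j - numOld u)
    rw [age, youngAge_eq hδ ih hg hs]
    split_ifs <;> positivity

theorem age_young (hω : ∀ u, IsTypical (ω u)) (hδ : -1 < δ) {j : ℕ} {u : Word}
    (hj : ¬ j < numOld u) :
    age δ ω (j :: u) = age δ ω u * (1 + arrival ω u (j - numOld u) / gam ω u) ^ (2 + δ) := by
  rw [age, if_neg hj]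
  exact youngAge_eq hδ (age_pos hω hδ u) (hω u).gam_pos (arrival_nonneg hω u _)

theorem age_le_age_young (hω : ∀ u, IsTypical (ω u)) (hδ : -1 < δ) {j : ℕ} {u : Word}
    (hj : ¬ j < numOld u) :
    age δ ω u ≤ age δ ω (j :: u) := by
  rw [age_young hω hδ hj]
  have hs := div_nonneg (arrival_nonneg hω u (j - numOld u)) (hω u).gam_pos.le
  exact le_mul_of_one_le_right (age_pos hω hδ u).le
    (Real.one_le_rpow (le_add_of_nonneg_right hs) (by linarith))

theorem numChildren_eq (hω : ∀ u, IsTypical (ω u)) (hδ : -1 < δ) (u : Word) :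
    numChildren δ ω u = numOld u + youngCount δ (ω u) (age δ ω u) := by
  rw [numChildren, numYoung, cumIntensity_eq hδ (age_pos hω hδ u), Real.one_rpow]
  rfl

theorem numChildren_nil (hω : ∀ u, IsTypical (ω u)) (hδ : -1 < δ) :
    numChildren δ ω [] = youngCount δ (ω []) (ω []).1 + 1 := by
  rw [numChildren_eq hω hδ, add_comm]
  rfl

theorem numChildren_singleton_zero (hω : ∀ u, IsTypical (ω u)) (hδ : -1 < δ) :
    numChildren δ ω [0] = youngCount δ (ω [0]) (olderAge δ (ω [0]) (ω []).1) + 1 := by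
  rw [numChildren_eq hω hδ, numOld_singleton_zero, add_comm, age_singleton_zero]

theorem numChildren_singleton_succ_le (hω : ∀ u, IsTypical (ω u)) (hδ : -1 < δ) (j : ℕ) :
    numChildren δ ω [j + 1] ≤ youngCount δ (ω [j + 1]) (ω []).1 := by
  rw [numChildren_eq hω hδ, numOld_singleton_succ, zero_add]
  have hage : age δ ω [] ≤ age δ ω [j + 1] := age_le_age_young hω hδ (by simp [numOld, label])
  exact (hω [j + 1]).youngCount_anti hδ (hω []).unif_mem.1 hage

theorem aemeasurable_age (hδ : -1 < δ) (u : Word) :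
    AEMeasurable (fun ω => age δ ω u) (sampleLaw δ hδ) := by
  have hunif (v : Word) : Measurable fun ω : Sample => unif ω v := by unfold unif; fun_prop
  induction u with
  | nil => exact (hunif []).aemeasurable
  | cons j u ih =>
    by_cases hj : j < numOld u
    · simp only [age, if_pos hj]
      exact ((hunif _).pow_const _).aemeasurable.mul ih
    · have hage : (fun ω => age δ ω u *
          (1 + arrival ω u (j - numOld u) / gam ω u) ^ (2 + δ)) =ᵐ[sampleLaw δ hδ]
          fun ω => age δ ω (j :: u) := by
        filter_upwards [ae_forall_isTypical hδ] with ω hω using (age_young hω hδ hj).symm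
      refine (ih.mul (Measurable.aemeasurable ?_)).congr hage
      unfold arrival gam
      fun_prop

theorem aemeasurable_numChildren (hδ : -1 < δ) (u : Word) :
    AEMeasurable (fun ω => numChildren δ ω u) (sampleLaw δ hδ) := by
  have hcount : Measurable fun p : Noise × ℝ => numOld u + youngCount δ p.1 p.2 := by fun_prop
  have heval : Measurable fun ω : Sample => ω u := measurable_pi_apply u
  refine (hcount.comp_aemeasurable
    (heval.aemeasurable.prodMk (aemeasurable_age hδ u))).congr ?_
  filter_upwards [ae_forall_isTypical hδ] with ω hω using (numChildren_eq hω hδ u).symm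

theorem measurable_rootBias : Measurable rootBias := by
  have hcurried : Measurable fun q : ℕ × (Word → ℕ) =>
      if q.1 = 0 then (0 : ℝ)
      else (∑ j ∈ Finset.range q.1, ((q.2 [j] : ℝ) + 1)) / (q.1 : ℝ) - (q.1 : ℝ) := by
    refine measurable_from_prod_countable_right fun k => ?_
    by_cases hk : k = 0
    · simp only [hk, if_true]
      exact measurable_const
    · simp only [if_neg hk]
      fun_prop
  have hroot : Measurable fun c : Word → ℕ => (c [], c) := by fun_prop
  exact hcurried.comp hroot

theorem biasLaw_Ici (hδ : -1 < δ) (x : ℝ) :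
    biasLaw δ hδ (Ici x) = sampleLaw δ hδ {ω | x ≤ rootBias (numChildren δ ω)} := by
  have h : AEMeasurable (fun ω => rootBias (numChildren δ ω)) (sampleLaw δ hδ) :=
    measurable_rootBias.comp_aemeasurable
      (aemeasurable_pi_lambda _ (aemeasurable_numChildren hδ))
  rw [biasLaw, Measure.map_apply_of_aemeasurable h measurableSet_Ici]
  rfl

end Tree

section OlderChild

theorem one_add_rpow_neg_le {β s y : ℝ} (hβ : 0 ≤ β) (hs : 0 ≤ s) (hy : 0 < y) :
    (1 + s) ^ (-β) ≤ y ^ (-β) + Real.exp (y - s) := by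
  rcases le_total y s with hle | hle
  · have hpow : (1 + s) ^ (-β) ≤ y ^ (-β) :=
      Real.rpow_le_rpow_of_nonpos hy (by linarith) (neg_nonpos.2 hβ)
    linarith [Real.exp_pos (y - s)]
  · have hpow : (1 + s) ^ (-β) ≤ 1 :=
      Real.rpow_le_one_of_one_le_of_nonpos (by linarith) (neg_nonpos.2 hβ)
    linarith [Real.one_le_exp (sub_nonneg.2 hle), Real.rpow_nonneg hy.le (-β)]

theorem exp_half_mul_inv_two_pow_le {β : ℝ} (hβ : 0 ≤ β) (m : ℕ) :
    Real.exp ((m + 1) / 2) * 2⁻¹ ^ (m + 1) ≤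
      (β / (Real.log 2 - 1 / 2)) ^ β * ((m : ℝ) + 1) ^ (-β) := by
  have hlog : 0 < Real.log 2 - 1 / 2 := by linarith [Real.log_two_gt_d9]
  have htwo : (2⁻¹ : ℝ) ^ (m + 1) = Real.exp (-(Real.log 2 * (m + 1))) := by
    rw [Real.exp_neg, Real.exp_mul, Real.exp_log two_pos]
    norm_cast
    simp
  have hexp : Real.exp ((m + 1) / 2) * 2⁻¹ ^ (m + 1) =
      (Real.exp ((Real.log 2 - 1 / 2) * (m + 1)))⁻¹ := by
    rw [htwo, ← Real.exp_add, ← Real.exp_neg]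
    ring_nf
  have hdom := rpow_abs_le_mul_exp_abs ((m : ℝ) + 1) hβ hlog.ne'
  rw [abs_of_pos hlog, abs_of_pos (by positivity)] at hdom
  rwa [hexp, Real.rpow_neg (by positivity), ← div_eq_mul_inv, le_div_iff₀ (by positivity),
    inv_mul_le_iff₀ (Real.exp_pos _), mul_comm]

theorem exists_lintegral_one_add_arrivalTime_rpow_neg_le {β : ℝ} (hβ : 0 ≤ β) :
    ∃ K ≠ ⊤, ∀ m : ℕ, ∫⁻ t, ENNReal.ofReal ((1 + arrivalTime t m) ^ (-β)) ∂interarrivalLaw ≤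
      K * ENNReal.ofReal (((m : ℝ) + 1) ^ (-β)) := by
  set C := (β / (Real.log 2 - 1 / 2)) ^ β
  have hC : 0 ≤ C :=
    Real.rpow_nonneg (div_nonneg hβ (by linarith [Real.log_two_gt_d9])) _
  refine ⟨ENNReal.ofReal (2 ^ β + C), by finiteness, fun m => ?_⟩
  have hpoint : ∀ᵐ t ∂interarrivalLaw, ENNReal.ofReal ((1 + arrivalTime t m) ^ (-β)) ≤
      ENNReal.ofReal (((m + 1) / 2) ^ (-β)) +
        ENNReal.ofReal (Real.exp ((m + 1) / 2)) *
          ENNReal.ofReal (Real.exp (-arrivalTime t m)) := by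
    filter_upwards [ae_interarrivalLaw_nonneg] with t ht
    rw [← ENNReal.ofReal_mul (by positivity), ← Real.exp_add,
      ← ENNReal.ofReal_add (by positivity) (by positivity)]
    exact ENNReal.ofReal_le_ofReal
      (one_add_rpow_neg_le hβ (Finset.sum_nonneg fun i _ => ht i) (by positivity))
  have hhalf : (((m : ℝ) + 1) / 2) ^ (-β) = 2 ^ β * ((m : ℝ) + 1) ^ (-β) := by
    rw [Real.div_rpow (by positivity) zero_le_two, Real.rpow_neg zero_le_two, div_inv_eq_mul,
      mul_comm]
  have htwo : (2⁻¹ : ℝ≥0∞) ^ (m + 1) = ENNReal.ofReal (2⁻¹ ^ (m + 1)) := by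
    rw [ENNReal.ofReal_pow (by norm_num), ENNReal.ofReal_inv_of_pos two_pos, ENNReal.ofReal_ofNat]
  calc ∫⁻ t, ENNReal.ofReal ((1 + arrivalTime t m) ^ (-β)) ∂interarrivalLaw
      ≤ ENNReal.ofReal (((m + 1) / 2) ^ (-β)) +
          ENNReal.ofReal (Real.exp ((m + 1) / 2)) * 2⁻¹ ^ (m + 1) := by
        refine (lintegral_mono_ae hpoint).trans_eq ?_
        rw [lintegral_add_left measurable_const, lintegral_const, measure_univ, mul_one,
          lintegral_const_mul _ (by fun_prop), lintegral_exp_neg_arrivalTime]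
    _ ≤ ENNReal.ofReal ((2 ^ β + C) * ((m : ℝ) + 1) ^ (-β)) := by
        rw [htwo, ← ENNReal.ofReal_mul (by positivity),
          ← ENNReal.ofReal_add (by positivity) (by positivity), hhalf, add_mul]
        exact ENNReal.ofReal_le_ofReal (add_le_add_right (exp_half_mul_inv_two_pow_le hβ m) _)
    _ = _ := ENNReal.ofReal_mul (by positivity)

theorem one_add_div_rpow_neg_le {β g s : ℝ} (hβ : 0 ≤ β) (hg : 0 < g) (hs : 0 ≤ s) :
    (1 + s / g) ^ (-β) ≤ (1 + g) ^ β * (1 + s) ^ (-β) := by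
  have hle : (1 + s) / (1 + g) ≤ 1 + s / g := by
    rw [div_le_iff₀ (by positivity)]
    have : (1 + s / g) * (1 + g) = 1 + s + g + s / g := by field_simp; ring
    rw [this]
    have := div_nonneg hs hg.le
    linarith
  refine (Real.rpow_le_rpow_of_nonpos (by positivity) hle (neg_nonpos.2 hβ)).trans_eq ?_
  rw [Real.div_rpow (by positivity) (by positivity), Real.rpow_neg (by positivity : 0 ≤ 1 + g),
    div_inv_eq_mul, mul_comm]

theorem exists_lintegral_one_add_arrivalTime_div_rpow_neg_le {a r β : ℝ} (ha : 0 < a) (hr : 0 < r)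
    (hβ : 0 ≤ β) :
    ∃ K ≠ ⊤, ∀ m : ℕ, ∫⁻ g, ∫⁻ t, ENNReal.ofReal ((1 + arrivalTime t m / g) ^ (-β))
      ∂interarrivalLaw ∂gammaMeasure a r ≤ K * ENNReal.ofReal (((m : ℝ) + 1) ^ (-β)) := by
  obtain ⟨K, hK, hS⟩ := exists_lintegral_one_add_arrivalTime_rpow_neg_le hβ
  have hG := lintegral_one_add_rpow_gammaMeasure_ne_top ha hr hβ
  refine ⟨K * ∫⁻ g, ENNReal.ofReal ((1 + g) ^ β) ∂gammaMeasure a r, by finiteness, fun m => ?_⟩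
  have hinner : ∀ᵐ g ∂gammaMeasure a r,
      ∫⁻ t, ENNReal.ofReal ((1 + arrivalTime t m / g) ^ (-β)) ∂interarrivalLaw ≤
        K * ENNReal.ofReal (((m : ℝ) + 1) ^ (-β)) * ENNReal.ofReal ((1 + g) ^ β) := by
    filter_upwards [gammaMeasure_ae_pos a r] with g hg
    calc ∫⁻ t, ENNReal.ofReal ((1 + arrivalTime t m / g) ^ (-β)) ∂interarrivalLaw
        ≤ ∫⁻ t, ENNReal.ofReal ((1 + g) ^ β) *
            ENNReal.ofReal ((1 + arrivalTime t m) ^ (-β)) ∂interarrivalLaw := by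
          refine lintegral_mono_ae ?_
          filter_upwards [ae_interarrivalLaw_nonneg] with t ht
          rw [← ENNReal.ofReal_mul (by positivity)]
          gcongr
          exact one_add_div_rpow_neg_le hβ hg (Finset.sum_nonneg fun i _ => ht i)
      _ = ENNReal.ofReal ((1 + g) ^ β) *
            ∫⁻ t, ENNReal.ofReal ((1 + arrivalTime t m) ^ (-β)) ∂interarrivalLaw :=
          lintegral_const_mul _ (by fun_prop)
      _ ≤ ENNReal.ofReal ((1 + g) ^ β) * (K * ENNReal.ofReal (((m : ℝ) + 1) ^ (-β))) := by
          gcongr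
          exact hS m
      _ = _ := mul_comm _ _
  refine (lintegral_mono_ae hinner).trans_eq ?_
  rw [lintegral_const_mul _ (by fun_prop)]
  ring

variable {δ : ℝ}

theorem noiseLaw_unif_le (hδ : -1 < δ) (u : Word) {r : ℝ → (ℕ → ℝ) → ℝ}
    (hr : Measurable r.uncurry) :
    noiseLaw δ u {n | n.1 ≤ r n.2.1 n.2.2} ≤
      ∫⁻ g, ∫⁻ t, ENNReal.ofReal (r g t) ∂interarrivalLaw ∂gammaMeasure (gammaShape δ u) 1 := by
  have hset : MeasurableSet {n : Noise | n.1 ≤ r n.2.1 n.2.2} :=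
    measurableSet_le measurable_fst (hr.comp measurable_snd)
  rw [← lintegral_indicator_one hset,
    lintegral_noiseLaw hδ u (measurable_one.indicator hset)]
  gcongr with g t
  have hslice : ∫⁻ x, {n : Noise | n.1 ≤ r n.2.1 n.2.2}.indicator 1 (x, g, t)
      ∂volume.restrict (Icc (0 : ℝ) 1) = volume.restrict (Icc (0 : ℝ) 1) (Iic (r g t)) :=
    lintegral_indicator_one (s := Iic (r g t)) measurableSet_Iic
  rw [hslice, restrict_Icc_Iic]
  exact ENNReal.ofReal_le_ofReal (min_le_left _ _)

theorem exists_noiseLaw_lt_youngCount_olderAge_le (hδ : -1 < δ) (u : Word) :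
    ∃ K ≠ ⊤, ∀ a, 0 < a → ∀ m : ℕ, noiseLaw δ u {n | m < youngCount δ n (olderAge δ n a)} ≤
      K * ENNReal.ofReal (((m : ℝ) + 1) ^ (-(1 + δ))) *
        ENNReal.ofReal (a ^ (-((1 + δ) / (2 + δ)))) := by
  obtain ⟨K, hK, hbound⟩ := exists_lintegral_one_add_arrivalTime_div_rpow_neg_le
    (gammaShape_pos hδ u) one_pos (by linarith : 0 ≤ 1 + δ)
  refine ⟨K, hK, fun a ha m => ?_⟩
  set c := a ^ (-((1 + δ) / (2 + δ)))
  have hc : 0 ≤ c := by positivity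
  calc noiseLaw δ u {n | m < youngCount δ n (olderAge δ n a)}
      ≤ noiseLaw δ u {n | n.1 ≤ c * (1 + arrivalTime n.2.2 m / n.2.1) ^ (-(1 + δ))} :=
        measure_mono_ae <| (ae_isTypical hδ u).mono fun n hn =>
          (hn.lt_youngCount_olderAge_iff hδ ha).1
    _ ≤ ∫⁻ g, ∫⁻ t, ENNReal.ofReal (c * (1 + arrivalTime t m / g) ^ (-(1 + δ)))
          ∂interarrivalLaw ∂gammaMeasure (gammaShape δ u) 1 :=
        noiseLaw_unif_le hδ u (r := fun g t => c * (1 + arrivalTime t m / g) ^ (-(1 + δ)))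
          (by unfold Function.uncurry; fun_prop)
    _ = (∫⁻ g, ∫⁻ t, ENNReal.ofReal ((1 + arrivalTime t m / g) ^ (-(1 + δ)))
          ∂interarrivalLaw ∂gammaMeasure (gammaShape δ u) 1) * ENNReal.ofReal c := by
        simp_rw [ENNReal.ofReal_mul hc]
        simp_rw [lintegral_const_mul' _ _ ENNReal.ofReal_ne_top]
        exact mul_comm _ _
    _ ≤ _ := by gcongr; exact hbound m

theorem exists_sampleLaw_lt_youngCount_olderAge_le (hδ : -1 < δ) :
    ∃ K ≠ ⊤, ∀ m : ℕ,
      sampleLaw δ hδ {ω | m < youngCount δ (ω [0]) (olderAge δ (ω [0]) (ω []).1)} ≤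
        K * ENNReal.ofReal (((m : ℝ) + 1) ^ (-(1 + δ))) := by
  have hprob := isProbabilityMeasure_noiseLaw hδ
  obtain ⟨K, hK, hbound⟩ := exists_noiseLaw_lt_youngCount_olderAge_le hδ [0]
  have hexp : -1 < -((1 + δ) / (2 + δ)) := by
    rw [neg_lt_neg_iff, div_lt_one (by linarith)]
    linarith
  have hA := lintegral_rpow_restrict_Icc_ne_top hexp
  refine ⟨K * ∫⁻ x, ENNReal.ofReal (x ^ (-((1 + δ) / (2 + δ)))) ∂volume.restrict (Icc (0 : ℝ) 1),
    by finiteness, fun m => ?_⟩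
  set S : Set (Noise × Noise) := {q | m < youngCount δ q.2 (olderAge δ q.2 q.1.1)}
  have hSmeas : MeasurableSet S := by
    unfold S olderAge
    exact measurableSet_lt measurable_const (by fun_prop)
  calc sampleLaw δ hδ {ω | m < youngCount δ (ω [0]) (olderAge δ (ω [0]) (ω []).1)}
      = ((noiseLaw δ []).prod (noiseLaw δ [0])) S :=
        (measurePreserving_eval_pair_sampleLaw hδ (by simp : ([] : Word) ≠ [0])).measure_preimage
          hSmeas.nullMeasurableSet
    _ = ∫⁻ n, noiseLaw δ [0] {n' | m < youngCount δ n' (olderAge δ n' n.1)} ∂noiseLaw δ [] :=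
        Measure.prod_apply hSmeas
    _ ≤ ∫⁻ n, K * ENNReal.ofReal (((m : ℝ) + 1) ^ (-(1 + δ))) *
          ENNReal.ofReal (n.1 ^ (-((1 + δ) / (2 + δ)))) ∂noiseLaw δ [] :=
        lintegral_mono_ae <| (ae_isTypical hδ []).mono fun n hn => hbound n.1 hn.unif_mem.1 m
    _ = _ := by
        rw [lintegral_const_mul _ (by fun_prop),
          (measurePreserving_fst_noiseLaw hδ []).lintegral_comp
            (f := fun x => ENNReal.ofReal (x ^ (-((1 + δ) / (2 + δ))))) (by fun_prop)]
        ring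

theorem exists_sampleLaw_le_numChildren_older_le (hδ : -1 < δ) :
    ∃ K ≠ ⊤, ∀ x : ℝ, 8 ≤ x →
      sampleLaw δ hδ {ω | x / 2 ≤ (numChildren δ ω [0] : ℝ) + 1} ≤
        K * ENNReal.ofReal (x ^ (-(1 + δ))) := by
  obtain ⟨K, hK, hbound⟩ := exists_sampleLaw_lt_youngCount_olderAge_le hδ
  refine ⟨K * ENNReal.ofReal (4 ^ (1 + δ)), by finiteness, fun x hx => ?_⟩
  obtain ⟨m, hm⟩ : ∃ m, ⌈x / 4⌉₊ = m + 1 :=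
    Nat.exists_eq_succ_of_ne_zero (Nat.ceil_pos.2 (by positivity)).ne'
  have hxm : x / 4 ≤ m + 1 := by exact_mod_cast hm ▸ Nat.le_ceil (x / 4)
  have hsub : ∀ᵐ ω ∂sampleLaw δ hδ, x / 2 ≤ (numChildren δ ω [0] : ℝ) + 1 →
      m < youngCount δ (ω [0]) (olderAge δ (ω [0]) (ω []).1) := by
    filter_upwards [ae_forall_isTypical hδ] with ω hω h
    rw [numChildren_singleton_zero hω hδ] at h
    push_cast at h
    rw [← Nat.succ_le_iff, Nat.succ_eq_add_one, ← hm]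
    exact Nat.ceil_le.2 (by linarith)
  refine (measure_mono_ae hsub).trans ((hbound m).trans ?_)
  rw [mul_assoc, ← ENNReal.ofReal_mul (by positivity)]
  gcongr
  calc ((m : ℝ) + 1) ^ (-(1 + δ)) ≤ (x / 4) ^ (-(1 + δ)) :=
        Real.rpow_le_rpow_of_nonpos (by positivity) hxm (by linarith)
    _ = 4 ^ (1 + δ) * x ^ (-(1 + δ)) := by
        rw [Real.div_rpow (by positivity) (by norm_num), Real.rpow_neg zero_le_four,
          div_inv_eq_mul, mul_comm]

end OlderChild

section YoungerChildren

variable {δ p : ℝ}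

theorem exists_lintegral_youngCount_rpow_le (hδ : -1 < δ) (u : Word) (hp : 0 ≤ p) :
    ∃ K ≠ ⊤, ∀ a ∈ Ioc (0 : ℝ) 1,
      ∫⁻ n, ((youngCount δ n a : ℝ≥0∞) + 1) ^ p ∂noiseLaw δ u ≤
        K * ENNReal.ofReal (a ^ (-(p / (2 + δ)))) := by
  obtain ⟨K, hK, hbound⟩ := exists_lintegral_arrivalCount_rpow_le hp
  have hG := lintegral_one_add_rpow_gammaMeasure_ne_top (gammaShape_pos hδ u) one_pos hp
  refine ⟨K * ∫⁻ g, ENNReal.ofReal ((1 + g) ^ p) ∂gammaMeasure (gammaShape δ u) 1,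
    by finiteness, fun a ⟨ha0, ha1⟩ => ?_⟩
  set c := 1 / a ^ (1 / (2 + δ)) with hc
  have hexp : 0 ≤ 1 / (2 + δ) := one_div_nonneg.2 (by linarith)
  have hc1 : 1 ≤ c := one_le_one_div (by positivity) (Real.rpow_le_one ha0.le ha1 hexp)
  have hcp : c ^ p = a ^ (-(p / (2 + δ))) := by
    rw [hc, one_div, ← Real.rpow_neg ha0.le, ← Real.rpow_mul ha0.le]
    ring_nf
  have hinner : ∀ᵐ g ∂gammaMeasure (gammaShape δ u) 1,
      ∫⁻ t, ((arrivalCount t (g * (c - 1)) : ℝ≥0∞) + 1) ^ p ∂interarrivalLaw ≤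
        K * ENNReal.ofReal (a ^ (-(p / (2 + δ)))) * ENNReal.ofReal ((1 + g) ^ p) := by
    filter_upwards [gammaMeasure_ae_pos _ 1] with g hg
    have hmass : 1 + g * (c - 1) ≤ c * (1 + g) := by linarith
    have hnonneg : 0 ≤ g * (c - 1) := mul_nonneg hg.le (sub_nonneg.2 hc1)
    calc ∫⁻ t, ((arrivalCount t (g * (c - 1)) : ℝ≥0∞) + 1) ^ p ∂interarrivalLaw
        ≤ K * ENNReal.ofReal (1 + g * (c - 1)) ^ p := hbound _ hnonneg
      _ ≤ K * ENNReal.ofReal (c * (1 + g)) ^ p := by gcongr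
      _ = _ := by
        rw [ENNReal.ofReal_rpow_of_nonneg (by positivity) hp,
          Real.mul_rpow (by positivity) (by positivity), hcp, ENNReal.ofReal_mul (by positivity),
          mul_assoc]
  calc ∫⁻ n, ((youngCount δ n a : ℝ≥0∞) + 1) ^ p ∂noiseLaw δ u
      = ∫⁻ g, ∫⁻ t, ((arrivalCount t (g * (c - 1)) : ℝ≥0∞) + 1) ^ p ∂interarrivalLaw
          ∂gammaMeasure (gammaShape δ u) 1 := by
        rw [lintegral_noiseLaw hδ u (by fun_prop)]
        simp [youngCount, hc]
    _ ≤ _ := lintegral_mono_ae hinner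
    _ = _ := by
        rw [lintegral_const_mul _ (by fun_prop)]
        ring

/-- The weight that the younger child of the root with index `j` has in the average over all the
neighbours of the root, as a function of the randomness of the root; it is zero if there is no such
child. -/
def youngWeight (δ : ℝ) (j : ℕ) (n : Noise) : ℝ≥0∞ :=
  if j < youngCount δ n n.1 then ((youngCount δ n n.1 : ℝ≥0∞) + 1)⁻¹ else 0

@[fun_prop]
theorem measurable_youngWeight (δ : ℝ) (j : ℕ) : Measurable (youngWeight δ j) :=
  (measurable_of_countable fun k : ℕ => if j < k then ((k : ℝ≥0∞) + 1)⁻¹ else 0).comp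
    (by fun_prop : Measurable fun n : Noise => youngCount δ n n.1)

theorem tsum_youngWeight_mul (δ : ℝ) (n : Noise) (f : ℕ → ℝ≥0∞) :
    ∑' j, youngWeight δ j n * f j =
      ∑ j ∈ Finset.range (youngCount δ n n.1), ((youngCount δ n n.1 : ℝ≥0∞) + 1)⁻¹ * f j := by
  rw [tsum_eq_sum (s := Finset.range (youngCount δ n n.1)) fun j hj => by
    rw [youngWeight, if_neg (by simpa using hj), zero_mul]]
  exact Finset.sum_congr rfl fun j hj => by rw [youngWeight, if_pos (Finset.mem_range.1 hj)]

theorem sum_range_inv_le_one (k : ℕ) : ∑ _j ∈ Finset.range k, ((k : ℝ≥0∞) + 1)⁻¹ ≤ 1 := by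
  rw [Finset.sum_const, Finset.card_range, nsmul_eq_mul, ← div_eq_mul_inv]
  exact ENNReal.div_le_of_le_mul (by simp)

theorem tsum_youngWeight_le_one (δ : ℝ) (n : Noise) : ∑' j, youngWeight δ j n ≤ 1 := by
  simpa using (tsum_youngWeight_mul δ n 1).trans_le (by simpa using sum_range_inv_le_one _)

theorem lintegral_tsum_weight_le (hδ : -1 < δ) {u : Word} {v : ℕ → Word} (huv : ∀ j, u ≠ v j)
    {w : ℕ → Noise → ℝ≥0∞} (hw : ∀ j, Measurable (w j)) (hw1 : ∀ n, ∑' j, w j n ≤ 1)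
    {Z : Noise → Noise → ℝ≥0∞} (hZ : Measurable Z.uncurry) {B : Noise → ℝ≥0∞} (hB : Measurable B)
    (hZB : ∀ j, ∀ᵐ n ∂noiseLaw δ u, ∫⁻ n', Z n n' ∂noiseLaw δ (v j) ≤ B n) :
    ∫⁻ ω, ∑' j, w j (ω u) * Z (ω u) (ω (v j)) ∂sampleLaw δ hδ ≤ ∫⁻ n, B n ∂noiseLaw δ u := by
  have hprob := isProbabilityMeasure_noiseLaw hδ
  have hmeas (j : ℕ) : Measurable fun q : Noise × Noise => w j q.1 * Z q.1 q.2 :=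
    ((hw j).comp measurable_fst).mul hZ
  have hterm (j : ℕ) : ∫⁻ ω, w j (ω u) * Z (ω u) (ω (v j)) ∂sampleLaw δ hδ ≤
      ∫⁻ n, w j n * B n ∂noiseLaw δ u := by
    rw [(measurePreserving_eval_pair_sampleLaw hδ (huv j)).lintegral_comp (hmeas j),
      lintegral_prod _ (hmeas j).aemeasurable]
    refine lintegral_mono_ae ((hZB j).mono fun n hn => ?_)
    exact (lintegral_const_mul _ (hZ.comp measurable_prodMk_left)).trans_le
      (mul_le_mul_right hn _)
  calc ∫⁻ ω, ∑' j, w j (ω u) * Z (ω u) (ω (v j)) ∂sampleLaw δ hδ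
      = ∑' j, ∫⁻ ω, w j (ω u) * Z (ω u) (ω (v j)) ∂sampleLaw δ hδ :=
        lintegral_tsum fun j => ((hmeas j).comp (by fun_prop :
          Measurable fun ω : Sample => (ω u, ω (v j)))).aemeasurable
    _ ≤ ∑' j, ∫⁻ n, w j n * B n ∂noiseLaw δ u := ENNReal.tsum_le_tsum hterm
    _ = ∫⁻ n, ∑' j, w j n * B n ∂noiseLaw δ u :=
        (lintegral_tsum fun j => ((hw j).mul hB).aemeasurable).symm
    _ ≤ ∫⁻ n, B n ∂noiseLaw δ u := by
        gcongr with n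
        rw [ENNReal.tsum_mul_right]
        exact mul_le_of_le_one_left' (hw1 n)

theorem noiseLaw_singleton_succ (δ : ℝ) (j : ℕ) : noiseLaw δ [j + 1] = noiseLaw δ [1] := by
  simp [noiseLaw, gammaShape, label]

theorem lintegral_tsum_youngWeight_ne_top (hδ : -1 < δ) (hp0 : 0 ≤ p) (hp : p < 2 + δ) :
    ∫⁻ ω, ∑' j, youngWeight δ j (ω []) *
      ((youngCount δ (ω [j + 1]) (ω []).1 : ℝ≥0∞) + 1) ^ p ∂sampleLaw δ hδ ≠ ⊤ := by
  obtain ⟨K, hK, hbound⟩ := exists_lintegral_youngCount_rpow_le hδ [1] hp0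
  have hexp : -1 < -(p / (2 + δ)) := by
    rw [neg_lt_neg_iff, div_lt_one (by linarith)]
    exact hp
  refine ne_top_of_le_ne_top ?_ <| lintegral_tsum_weight_le hδ (u := []) (v := fun j => [j + 1])
    (by simp) (measurable_youngWeight δ) (tsum_youngWeight_le_one δ)
    (Z := fun n n' => ((youngCount δ n' n.1 : ℝ≥0∞) + 1) ^ p) (by unfold Function.uncurry; fun_prop)
    (B := fun n => K * ENNReal.ofReal (n.1 ^ (-(p / (2 + δ))))) (by fun_prop) fun j => ?_
  · rw [lintegral_const_mul _ (by fun_prop),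
      (measurePreserving_fst_noiseLaw hδ []).lintegral_comp
        (f := fun x => ENNReal.ofReal (x ^ (-(p / (2 + δ))))) (by fun_prop)]
    exact ENNReal.mul_ne_top hK (lintegral_rpow_restrict_Icc_ne_top hexp)
  · rw [noiseLaw_singleton_succ]
    exact (ae_isTypical hδ []).mono fun n hn => hbound n.1 hn.unif_mem

/-- The contribution of the younger children of the root to the average degree of its
neighbours, on the event that the root has one older child and `youngCount δ (ω []) (ω []).1`
younger ones. -/
def youngAverage (δ : ℝ) (ω : Sample) : ℝ :=
  (∑ j ∈ Finset.range (youngCount δ (ω []) (ω []).1), ((numChildren δ ω [j + 1] : ℝ) + 1)) /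
    ((youngCount δ (ω []) (ω []).1 : ℝ) + 1)

theorem ofReal_youngAverage_rpow_le (hδ : -1 < δ) {ω : Sample} (hω : ∀ u, IsTypical (ω u))
    (hp : 1 ≤ p) :
    ENNReal.ofReal (youngAverage δ ω) ^ p ≤
      ∑' j, youngWeight δ j (ω []) *
        ((youngCount δ (ω [j + 1]) (ω []).1 : ℝ≥0∞) + 1) ^ p := by
  set Y := youngCount δ (ω []) (ω []).1 with hY
  have haverage : ENNReal.ofReal (youngAverage δ ω) =
      ∑ j ∈ Finset.range Y, ((Y : ℝ≥0∞) + 1)⁻¹ * ((numChildren δ ω [j + 1] : ℝ≥0∞) + 1) := by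
    rw [youngAverage, div_eq_inv_mul, ← hY, ENNReal.ofReal_mul (by positivity),
      ENNReal.ofReal_inv_of_pos (by positivity), ofReal_natCast_add_one,
      ENNReal.ofReal_sum_of_nonneg fun j _ => by positivity, Finset.mul_sum]
    simp_rw [ofReal_natCast_add_one]
  rw [haverage, tsum_youngWeight_mul]
  refine (sum_mul_rpow_le _ _ (sum_range_inv_le_one Y) hp).trans ?_
  gcongr with j
  exact numChildren_singleton_succ_le hω hδ j

theorem exists_sampleLaw_le_youngAverage_le (hδ : -1 < δ) (hp1 : 1 ≤ p) (hp : p < 2 + δ) :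
    ∃ K ≠ ⊤, ∀ x : ℝ, 0 < x →
      sampleLaw δ hδ {ω | x / 2 ≤ youngAverage δ ω} ≤ K * ENNReal.ofReal (x ^ (-p)) := by
  set W : Sample → ℝ≥0∞ := fun ω => ∑' j, youngWeight δ j (ω []) *
    ((youngCount δ (ω [j + 1]) (ω []).1 : ℝ≥0∞) + 1) ^ p
  have hWm : Measurable W := by fun_prop
  have hmoment : ∫⁻ ω, W ω ∂sampleLaw δ hδ ≠ ⊤ :=
    lintegral_tsum_youngWeight_ne_top hδ (by linarith) hp
  refine ⟨(∫⁻ ω, W ω ∂sampleLaw δ hδ) * ENNReal.ofReal (2 ^ p), by finiteness, fun x hx => ?_⟩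
  have hsub : ∀ᵐ ω ∂sampleLaw δ hδ, x / 2 ≤ youngAverage δ ω →
      ENNReal.ofReal ((x / 2) ^ p) ≤ W ω := by
    filter_upwards [ae_forall_isTypical hδ] with ω hω h
    rw [← ENNReal.ofReal_rpow_of_pos (by positivity)]
    refine le_trans ?_ (ofReal_youngAverage_rpow_le hδ hω hp1)
    gcongr
  calc sampleLaw δ hδ {ω | x / 2 ≤ youngAverage δ ω}
      ≤ sampleLaw δ hδ {ω | ENNReal.ofReal ((x / 2) ^ p) ≤ W ω} := measure_mono_ae hsub
    _ ≤ (∫⁻ ω, W ω ∂sampleLaw δ hδ) / ENNReal.ofReal ((x / 2) ^ p) :=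
        meas_ge_le_lintegral_div hWm.aemeasurable
          (ENNReal.ofReal_pos.2 (by positivity)).ne' ENNReal.ofReal_ne_top
    _ = _ := by
        rw [div_eq_mul_inv, ← ENNReal.ofReal_inv_of_pos (by positivity), mul_assoc,
          ← ENNReal.ofReal_mul (by positivity), Real.div_rpow hx.le zero_le_two, inv_div,
          Real.rpow_neg hx.le, div_eq_mul_inv]

end YoungerChildren

section BiasTail

variable {δ : ℝ}

theorem rootBias_of_eq_add_one {c : Word → ℕ} {k : ℕ} (h : c [] = k + 1) :
    rootBias c = ((c [0] : ℝ) + 1) / (k + 1) +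
      (∑ j ∈ Finset.range k, ((c [j + 1] : ℝ) + 1)) / (k + 1) - (k + 1) := by
  rw [rootBias, h, if_neg k.succ_ne_zero, Finset.sum_range_succ', ← add_div,
    add_comm (∑ j ∈ Finset.range k, _)]
  push_cast
  rfl

theorem rootBias_le_add_youngAverage (hδ : -1 < δ) {ω : Sample} (hω : ∀ u, IsTypical (ω u)) :
    rootBias (numChildren δ ω) ≤ (numChildren δ ω [0] : ℝ) + 1 + youngAverage δ ω := by
  rw [rootBias_of_eq_add_one (numChildren_nil hω hδ), ← youngAverage]
  have hdiv : ((numChildren δ ω [0] : ℝ) + 1) / ((youngCount δ (ω []) (ω []).1 : ℝ) + 1) ≤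
      (numChildren δ ω [0] : ℝ) + 1 :=
    div_le_self (by positivity) (by simp)
  linarith [(youngCount δ (ω []) (ω []).1).cast_nonneg (α := ℝ)]

theorem exists_biasLaw_Ici_le (hδ : -1 < δ) :
    ∃ K < ⊤, ∀ᶠ x in atTop, biasLaw δ hδ (Ici x) ≤ K * ENNReal.ofReal (x ^ (-(1 + δ))) := by
  obtain ⟨K, hK, holder⟩ := exists_sampleLaw_le_numChildren_older_le hδ
  obtain ⟨L, hL, hyoung⟩ := exists_sampleLaw_le_youngAverage_le hδ (le_max_left 1 (1 + δ))
    (max_lt (by linarith) (by linarith))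
  refine ⟨K + L, by finiteness, ?_⟩
  filter_upwards [eventually_ge_atTop 8] with x hx
  have hsplit : ∀ᵐ ω ∂sampleLaw δ hδ, x ≤ rootBias (numChildren δ ω) →
      x / 2 ≤ (numChildren δ ω [0] : ℝ) + 1 ∨ x / 2 ≤ youngAverage δ ω := by
    filter_upwards [ae_forall_isTypical hδ] with ω hω hbias
    by_contra! h
    linarith [rootBias_le_add_youngAverage hδ hω]
  calc biasLaw δ hδ (Ici x)
      = sampleLaw δ hδ {ω | x ≤ rootBias (numChildren δ ω)} := biasLaw_Ici hδ x
    _ ≤ sampleLaw δ hδ {ω | x / 2 ≤ (numChildren δ ω [0] : ℝ) + 1} +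
          sampleLaw δ hδ {ω | x / 2 ≤ youngAverage δ ω} :=
        (measure_mono_ae hsplit).trans (measure_union_le _ _)
    _ ≤ K * ENNReal.ofReal (x ^ (-(1 + δ))) + L * ENNReal.ofReal (x ^ (-max 1 (1 + δ))) :=
        add_le_add (holder x hx) (hyoung x (by linarith))
    _ ≤ K * ENNReal.ofReal (x ^ (-(1 + δ))) + L * ENNReal.ofReal (x ^ (-(1 + δ))) := by
        gcongr
        · linarith
        · exact le_max_right _ _
    _ = (K + L) * ENNReal.ofReal (x ^ (-(1 + δ))) := (add_mul ..).symm

theorem noiseLaw_youngCount_eq_zero_ne_zero (hδ : -1 < δ) (u : Word) :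
    noiseLaw δ u {n | youngCount δ n n.1 = 0} ≠ 0 := by
  have hunif : volume.restrict (Icc (0 : ℝ) 1) (Ioi 2⁻¹) ≠ 0 := by
    have hset : Ioi (2⁻¹ : ℝ) ∩ Icc 0 1 = Ioc 2⁻¹ 1 := by grind
    rw [Measure.restrict_apply measurableSet_Ioi, hset, Real.volume_Ioc]
    norm_num
  have hgam : gammaMeasure (gammaShape δ u) 1 (Ioc 0 1) ≠ 0 :=
    gammaMeasure_apply_ne_zero (gammaShape_pos hδ u) one_pos measurableSet_Ioc Ioc_subset_Ioi_self
      (by simp)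
  have harrival : interarrivalLaw {t | 1 < t 0} ≠ 0 :=
    ((measurePreserving_eval_interarrivalLaw 0).measure_preimage
      measurableSet_Ioi.nullMeasurableSet).trans_ne <|
        gammaMeasure_apply_ne_zero one_pos one_pos measurableSet_Ioi (Ioi_subset_Ioi zero_le_one)
          (by simp)
  have hsub : Ioi 2⁻¹ ×ˢ Ioc 0 1 ×ˢ {t | 1 < t 0} ≤ᵐ[noiseLaw δ u]
      {n | youngCount δ n n.1 = 0} := by
    filter_upwards [ae_isTypical hδ u] with n hn ⟨ha, ⟨hg0, hg1⟩, ht⟩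
    replace ha : 2⁻¹ < n.1 := ha
    replace ht : 1 < n.2.2 0 := ht
    by_contra hne
    have hle := (hn.lt_youngCount_iff hδ hn.unif_mem.1).1 (Nat.pos_of_ne_zero hne)
    have hbase : 2 ≤ 1 + arrivalTime n.2.2 0 / n.2.1 := by
      have : 1 ≤ n.2.2 0 / n.2.1 := (one_le_div hg0).2 (hg1.trans ht.le)
      simp only [arrivalTime, zero_add, Finset.sum_range_one]
      linarith
    have hpow : 2 ≤ (1 + arrivalTime n.2.2 0 / n.2.1) ^ (2 + δ) :=
      hbase.trans (Real.self_le_rpow_of_one_le (by linarith) (by linarith))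
    nlinarith
  refine fun h0 => mul_ne_zero hunif (mul_ne_zero hgam harrival) ?_
  rw [← noiseLaw_prod hδ]
  exact nonpos_iff_eq_zero.1 (h0 ▸ measure_mono_ae hsub)

theorem exists_le_noiseLaw_lt_youngCount_olderAge (hδ : -1 < δ) (u : Word) :
    ∃ c > 0, ∀ m : ℕ, c * ENNReal.ofReal (((m : ℝ) + 1) ^ (-(1 + δ))) ≤
      noiseLaw δ u {n | m < youngCount δ n (olderAge δ n 1)} := by
  have hgam : gammaMeasure (gammaShape δ u) 1 (Ioi 1) ≠ 0 :=
    gammaMeasure_apply_ne_zero (gammaShape_pos hδ u) one_pos measurableSet_Ioi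
      (Ioi_subset_Ioi zero_le_one) (by simp)
  have hpos : ENNReal.ofReal (3 ^ (-(1 + δ))) ≠ 0 := (ENNReal.ofReal_pos.2 (by positivity)).ne'
  refine ⟨ENNReal.ofReal (3 ^ (-(1 + δ))) * (gammaMeasure (gammaShape δ u) 1 (Ioi 1) * 2⁻¹),
    pos_iff_ne_zero.2 (mul_ne_zero hpos (mul_ne_zero hgam (by simp))), fun m => ?_⟩
  set r : ℝ := (3 * (m + 1)) ^ (-(1 + δ)) with hr
  have hr1 : r ≤ 1 := Real.rpow_le_one_of_one_le_of_nonpos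
    (by linarith [m.cast_nonneg (α := ℝ)]) (by linarith)
  have hsub : Iic r ×ˢ Ioi 1 ×ˢ {t | arrivalTime t m ≤ 2 * (m + 1)} ≤ᵐ[noiseLaw δ u]
      {n | m < youngCount δ n (olderAge δ n 1)} := by
    filter_upwards [ae_isTypical hδ u] with n hn ⟨hU, hg, ht⟩
    replace hg : 1 < n.2.1 := hg
    replace ht : arrivalTime n.2.2 m ≤ 2 * (m + 1) := ht
    have hS : 0 ≤ arrivalTime n.2.2 m := Finset.sum_nonneg fun i _ => hn.isInterarrival.nonneg i
    have hdiv : arrivalTime n.2.2 m / n.2.1 ≤ arrivalTime n.2.2 m := div_le_self hS hg.le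
    refine (hn.lt_youngCount_olderAge_iff hδ one_pos).2 (hU.trans ?_)
    rw [Real.one_rpow, one_mul, hr]
    exact Real.rpow_le_rpow_of_nonpos (by positivity) (by linarith [m.cast_nonneg (α := ℝ)])
      (by linarith)
  calc ENNReal.ofReal (3 ^ (-(1 + δ))) * (gammaMeasure (gammaShape δ u) 1 (Ioi 1) * 2⁻¹) *
        ENNReal.ofReal (((m : ℝ) + 1) ^ (-(1 + δ)))
      = ENNReal.ofReal r * (gammaMeasure (gammaShape δ u) 1 (Ioi 1) * 2⁻¹) := by
        rw [hr, Real.mul_rpow (by positivity) (by positivity), ENNReal.ofReal_mul (by positivity)]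
        ring
    _ ≤ ENNReal.ofReal r * (gammaMeasure (gammaShape δ u) 1 (Ioi 1) *
          interarrivalLaw {t | arrivalTime t m ≤ 2 * (m + 1)}) := by
        gcongr
        exact half_le_interarrivalLaw_arrivalTime_le m
    _ = noiseLaw δ u (Iic r ×ˢ Ioi 1 ×ˢ {t | arrivalTime t m ≤ 2 * (m + 1)}) := by
        rw [noiseLaw_prod hδ, restrict_Icc_Iic, min_eq_left hr1]
    _ ≤ _ := measure_mono_ae hsub

theorem lt_rootBias (hδ : -1 < δ) {ω : Sample} (hω : ∀ u, IsTypical (ω u)) {m : ℕ}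
    (hroot : youngCount δ (ω []) (ω []).1 = 0)
    (holder : m < youngCount δ (ω [0]) (olderAge δ (ω [0]) 1)) :
    (m : ℝ) < rootBias (numChildren δ ω) := by
  have hanti : youngCount δ (ω [0]) (olderAge δ (ω [0]) 1) ≤
      youngCount δ (ω [0]) (olderAge δ (ω [0]) (ω []).1) := by
    have hU := (hω [0]).unif_mem.1
    have ha := (hω []).unif_mem
    have hpow := Real.rpow_pos_of_pos hU ((2 + δ) / (1 + δ))
    exact (hω [0]).youngCount_anti hδ (mul_pos hpow ha.1) (mul_le_mul_of_nonneg_left ha.2 hpow.le)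
  rw [rootBias_of_eq_add_one (k := 0) (by rw [numChildren_nil hω hδ, hroot]),
    numChildren_singleton_zero hω hδ]
  simp only [Finset.range_zero, Finset.sum_empty, Nat.cast_zero, zero_add, div_one, add_zero,
    add_sub_cancel_right, Nat.cast_lt]
  omega

theorem exists_le_biasLaw_Ici (hδ : -1 < δ) :
    ∃ c > 0, ∀ᶠ x in atTop, c * ENNReal.ofReal (x ^ (-(1 + δ))) ≤ biasLaw δ hδ (Ici x) := by
  have hprob := isProbabilityMeasure_noiseLaw hδ
  obtain ⟨c, hc, holder⟩ := exists_le_noiseLaw_lt_youngCount_olderAge hδ [0]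
  have hroot := noiseLaw_youngCount_eq_zero_ne_zero hδ []
  set A : Set Noise := {n | youngCount δ n n.1 = 0}
  refine ⟨noiseLaw δ [] A * (c * ENNReal.ofReal (3 ^ (-(1 + δ)))),
    ENNReal.mul_pos hroot (ENNReal.mul_pos hc.ne'
      (ENNReal.ofReal_pos.2 (by positivity)).ne').ne', ?_⟩
  filter_upwards [eventually_ge_atTop 1] with x hx
  set m := ⌈x⌉₊
  set B : Set Noise := {n | m < youngCount δ n (olderAge δ n 1)}
  have hmx : (m : ℝ) + 1 ≤ 3 * x := by linarith [Nat.ceil_lt_add_one (zero_le_one.trans hx)]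
  have hAB : MeasurableSet (A ×ˢ B) :=
    (measurableSet_eq_fun (by fun_prop) measurable_const).prod
      (measurableSet_lt measurable_const (by unfold olderAge; fun_prop))
  have hsub : ∀ᵐ ω ∂sampleLaw δ hδ, (ω [], ω [0]) ∈ A ×ˢ B →
      x ≤ rootBias (numChildren δ ω) := by
    filter_upwards [ae_forall_isTypical hδ] with ω hω ⟨hωA, hωB⟩
    exact (Nat.le_ceil x).trans (lt_rootBias hδ hω hωA hωB).le
  calc noiseLaw δ [] A * (c * ENNReal.ofReal (3 ^ (-(1 + δ)))) * ENNReal.ofReal (x ^ (-(1 + δ)))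
      = noiseLaw δ [] A * (c * ENNReal.ofReal ((3 * x) ^ (-(1 + δ)))) := by
        rw [Real.mul_rpow (by positivity) (by positivity), ENNReal.ofReal_mul (by positivity)]
        ring
    _ ≤ noiseLaw δ [] A * (c * ENNReal.ofReal (((m : ℝ) + 1) ^ (-(1 + δ)))) := by
        gcongr _ * (_ * ENNReal.ofReal ?_)
        exact Real.rpow_le_rpow_of_nonpos (by positivity) hmx (by linarith)
    _ ≤ noiseLaw δ [] A * noiseLaw δ [0] B := mul_le_mul_right (holder m) _
    _ = sampleLaw δ hδ {ω | (ω [], ω [0]) ∈ A ×ˢ B} := by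
        rw [← Measure.prod_prod]
        exact ((measurePreserving_eval_pair_sampleLaw hδ (by simp)).measure_preimage
          hAB.nullMeasurableSet).symm
    _ ≤ sampleLaw δ hδ {ω | x ≤ rootBias (numChildren δ ω)} := measure_mono_ae hsub
    _ = biasLaw δ hδ (Ici x) := (biasLaw_Ici hδ x).symm

end BiasTail

end PolyaPointTree

theorem theorem14_general {δ : ℝ} (hδ : -1 < δ) (b : ℝ) :
    (b ≤ -(1 + δ) → 0 < liminf (fun x : ℝ => PolyaPointTree.biasLaw δ hδ (Ici x) /
        ENNReal.ofReal (x ^ b)) atTop) ∧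
    (-(1 + δ) ≤ b → limsup (fun x : ℝ => PolyaPointTree.biasLaw δ hδ (Ici x) /
        ENNReal.ofReal (x ^ b)) atTop < ⊤) := by
  obtain ⟨c, hc, hlow⟩ := PolyaPointTree.exists_le_biasLaw_Ici hδ
  obtain ⟨K, hK, hupp⟩ := PolyaPointTree.exists_biasLaw_Ici_le hδ
  refine ⟨fun hb => (PolyaPointTree.liminf_div_ofReal_rpow_pos hc hlow).trans_le ?_,
    fun hb => lt_of_le_of_lt ?_ (PolyaPointTree.limsup_div_ofReal_rpow_lt_top hK hupp)⟩
  · exact liminf_le_liminf (PolyaPointTree.eventually_div_ofReal_rpow_le hb)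
  · exact limsup_le_limsup (PolyaPointTree.eventually_div_ofReal_rpow_le hb)

theorem theorem14 (δ τ : ℝ) (hδ : -1 < δ) (hτ : τ = 3 + δ) :
    (δ < 0 → 0 < liminf (fun x : ℝ => PolyaPointTree.biasLaw δ hδ (Ici x) /
        ENNReal.ofReal (x ^ (-(3 * τ - 4)))) atTop) ∧
    (0 ≤ δ → 0 < liminf (fun x : ℝ => PolyaPointTree.biasLaw δ hδ (Ici x) /
        ENNReal.ofReal (x ^ (-(2 * τ - 1)))) atTop) ∧
    (-(1 / 2) ≤ δ → δ < 0 → limsup (fun x : ℝ => PolyaPointTree.biasLaw δ hδ (Ici x) /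
        ENNReal.ofReal (x ^ (-(3 - τ)))) atTop < ⊤) ∧
    (δ = 0 → limsup (fun x : ℝ => PolyaPointTree.biasLaw δ hδ (Ici x) /
        ENNReal.ofReal (x ^ (-1 : ℝ))) atTop < ⊤) ∧
    (0 < δ → limsup (fun x : ℝ => PolyaPointTree.biasLaw δ hδ (Ici x) /
        ENNReal.ofReal (x ^ (-(τ - 3)))) atTop < ⊤) := by
  subst hτ
  exact ⟨fun _ => (theorem14_general hδ _).1 (by linarith),
    fun _ => (theorem14_general hδ _).1 (by linarith),
    fun _ _ => (theorem14_general hδ _).2 (by linarith),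
    fun _ => (theorem14_general hδ _).2 (by linarith),
    fun _ => (theorem14_general hδ _).2 (by linarith)⟩

end
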